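/- **Setting.** A (small, coloured) prop $\mathcal T$ has a set $\operatorname{Col}\mathcal T$ of colours, a set $\mathcal T(a_1,\dots,a_n;b_1,\dots,b_m)$ of operations $\langle a_i\rangle\to\langle b_k\rangle$ for any two finite (possibly empty) lists of colours, identities, an associative unital vertical composition $\circ_v$, an associative horizontal composition $\circ_h$ (concatenating sources and targets, with the identity of the empty list as unit), and commuting actions $\sigma^*$, $\tau_*$ of the symmetric groups on inputs and outputs, subject to the usual compatibilities: interchange of $\circ_v$ and $\circ_h$, $f\circ_v\sigma_*g=\sigma^*f\circ_v g$, equivariance of both compositions, and symmetry of $\circ_h$ up to block transpositions. Maps of props are functions on colours and on operations that preserve all this structure. Angle brackets around operations denote iterated horizontal composition. *Internal hom.* For props $\mathcal R,\mathcal T$ the prop $\mathcal{H}om(\mathcal R,\mathcal T)$ has as colours the prop maps $\mathcal R\to\mathcal T$. An operation $\langle f_1,\dots,f_p\rangle\to\langle g_1,\dots,g_q\rangle$ is a $(p,q)$ natural transformation: a family $\xi_a\in\mathcal T(f_1a,\dots,f_pa;g_1a,\dots,g_qa)$, $a\in\operatorname{Col}\mathcal R$, such that for every $\phi\colon\langle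 a_i\rangle_{i=1}^n\to\langle b_k\rangle_{k=1}^m$ in $\mathcal R$ $$\bar\tau_*\langle g_\ell\phi\rangle_{\ell=1}^q\circ_v\tau_*\langle\xi_{a_i}\rangle_{i=1}^n=\bar\sigma^*\langle\xi_{b_k}\rangle_{k=1}^m\circ_v\sigma^*\langle f_j\phi\rangle_{j=1}^p,$$ where $\sigma,\bar\sigma,\tau,\bar\tau$ are the evident interchanges of double lists. Its prop structure is computed componentwise in $\mathcal T$. *Tensor product.* A bilinear map $\chi\colon(\mathcal R,\mathcal S)\to\mathcal T$ consists of a function $\operatorname{Col}\mathcal R\times\operatorname{Col}\mathcal S\to\operatorname{Col}\mathcal T$ and operations $\chi(\phi,c)$, $\chi(a,\psi)$ such that each $\chi(a,-)\colon\mathcal S\to\mathcal T$ and each $\chi(-,c)\colon\mathcal R\to\mathcal T$ is a prop map and, for all operations $\phi\colon\langle a_i\rangle\to\langle b_k\rangle$ of $\mathcal R$ and $\psi\colon\langle c_j\rangle\to\langle d_\ell\rangle$ of $\mathcal S$, the two composites $\langle\langle\chi(a_i,c_j)\rangle_i\rangle_j\to\langle\langle\chi(b_k,d_\ell)\rangle_k\rangle_\ell$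 agree, namely $\langle\chi(\phi,c_j)\rangle_j$ followed by $\langle\chi(b_k,\psi)\rangle_k$ and $\langle\chi(a_i,\psi)\rangle_i$ followed by $\langle\chi(\phi,d_\ell)\rangle_\ell$ (with interchanges of double lists inserted). The prop $\mathcal R\otimes\mathcal S$ has colours $\operatorname{Col}\mathcal R\times\operatorname{Col}\mathcal S$ and is generated by operations $\phi\otimes c$ and $a\otimes\psi$ subject to the relations that make $(\phi,c)\mapsto\phi\otimes c$, $(a,\psi)\mapsto a\otimes\psi$ a bilinear map; it is the universal target of bilinear maps from $(\mathcal R,\mathcal S)$. **Proposition.** There is an isomorphism of props $$\mathcal{H}om(\mathcal R\otimes\mathcal S,\mathcal T)\;\cong\;\mathcal{H}om(\mathcal R,\mathcal{H}om(\mathcal S,\mathcal T)),$$ natural in the props $\mathcal R$, $\mathcal S$, $\mathcal T$, whose restriction to colour sets is the tensor-hom bijection $$\operatorname{Hom}(\mathcal R\otimes\mathcal S,\mathcal T)\cong\operatorname{Hom}(\mathcal R,\mathcal{H}om(\mathcal S,\mathcal T))$$ that sends a prop map $g\colon\mathcal R\otimes\mathcal S\to\mathcal T$ to the prop map given on colours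 by $a\mapsto g(a\otimes-)$ and on operations by $\phi\mapsto(g(\phi\otimes c))_{c\in\operatorname{Col}\mathcal S}$. -/

import Mathlib

universe u

/-- A finite (possibly empty) list `⟨a_1, …, a_n⟩` of elements of `C`. -/
structure Prof (C : Type u) : Type u where
  len : ℕ
  get : Fin len → C

namespace Prof

variable {C D E : Type u}

/-- The list `⟨f a_1, …, f a_n⟩`. -/
abbrev map (f : C → D) (a : Prof C) : Prof D := ⟨a.len, fun i => f (a.get i)⟩

/-- The empty list. -/
abbrev nil : Prof C := ⟨0, Fin.elim0⟩

/-- Concatenation of lists. -/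
def append (a b : Prof C) : Prof C := ⟨a.len + b.len, Fin.append a.get b.get⟩

/-- Positions in the first part of a concatenation. -/
def inl (a b : Prof C) (i : Fin a.len) : Fin (a.append b).len := Fin.castAdd b.len i

/-- Positions in the second part of a concatenation. -/
def inr (a b : Prof C) (i : Fin b.len) : Fin (a.append b).len := Fin.natAdd a.len i

theorem append_cases {a b : Prof C} {p : Fin (a.append b).len → Prop}
    (hl : ∀ i, p (inl a b i)) (hr : ∀ i, p (inr a b i)) (i) : p i :=
  Fin.addCases hl hr i

@[simp] theorem get_inl (a b : Prof C) (i) : (a.append b).get (inl a b i) = a.get i :=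
  Fin.append_left _ _ _

@[simp] theorem get_inr (a b : Prof C) (i) : (a.append b).get (inr a b i) = b.get i :=
  Fin.append_right _ _ _

/-- The positions of a concatenation. -/
def pos (a b : Prof C) : Fin a.len ⊕ Fin b.len ≃ Fin (a.append b).len := finSumFinEquiv

@[simp] theorem pos_inl (a b : Prof C) (i) : pos a b (Sum.inl i) = inl a b i := rfl
@[simp] theorem pos_inr (a b : Prof C) (i) : pos a b (Sum.inr i) = inr a b i := rfl
@[simp] theorem pos_symm_inl (a b : Prof C) (i) : (pos a b).symm (inl a b i) = Sum.inl i :=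
  (Equiv.symm_apply_eq _).2 rfl
@[simp] theorem pos_symm_inr (a b : Prof C) (i) : (pos a b).symm (inr a b i) = Sum.inr i :=
  (Equiv.symm_apply_eq _).2 rfl

/-- A bijection of positions carrying the list `a` to the list `b`. If `a = ⟨a_i⟩` and
`σ` is a permutation then `σ` is an `Iso ⟨a_{σ i}⟩ ⟨a_i⟩`. Lists that are equal have the same
length and the order-preserving bijection is then an `Iso`; these play the role of casts. -/
@[ext] structure Iso (a b : Prof C) : Type where
  toEquiv : Fin a.len ≃ Fin b.len
  get_eq : ∀ i, b.get (toEquiv i) = a.get i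

namespace Iso

variable {a b c d : Prof C}

def refl (a : Prof C) : Iso a a := ⟨Equiv.refl _, fun _ => rfl⟩

def symm (σ : Iso a b) : Iso b a :=
  ⟨σ.toEquiv.symm, fun i => by rw [← σ.get_eq, Equiv.apply_symm_apply]⟩

def trans (σ : Iso a b) (τ : Iso b c) : Iso a c :=
  ⟨σ.toEquiv.trans τ.toEquiv, fun i => by
    rw [Equiv.trans_apply, τ.get_eq, σ.get_eq]⟩

/-- The image of a bijection of lists under a function on entries. -/
def map (f : C → D) (σ : Iso a b) : Iso (a.map f) (b.map f) :=
  ⟨σ.toEquiv, fun i => congrArg f (σ.get_eq i)⟩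

/-- The block sum `σ × τ`. -/
def append (σ : Iso a b) (τ : Iso c d) : Iso (a.append c) (b.append d) :=
  ⟨(pos a c).symm.trans ((Equiv.sumCongr σ.toEquiv τ.toEquiv).trans (pos b d)),
    append_cases (fun i => by simp [σ.get_eq]) (fun i => by simp [τ.get_eq])⟩

/-- The block transposition. -/
def swap (a b : Prof C) : Iso (a.append b) (b.append a) :=
  ⟨(pos a b).symm.trans ((Equiv.sumComm _ _).trans (pos b a)),
    append_cases (fun i => by simp) (fun i => by simp)⟩

/-- The order-preserving identification `(ab)c = a(bc)`. -/
def assoc (a b c : Prof C) : Iso ((a.append b).append c) (a.append (b.append c)) :=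
  ⟨finCongr (Nat.add_assoc _ _ _),
    fun i => (congrFun (Fin.append_assoc a.get b.get c.get) i).symm⟩

/-- The order-preserving identification `∅ a = a`. -/
def nilAppend (a : Prof C) : Iso (nil.append a) a :=
  ⟨finCongr (Nat.zero_add _), append_cases (fun i => i.elim0) (fun i => by
    rw [get_inr]; congr 1; exact Fin.ext (Nat.zero_add _))⟩

/-- The order-preserving identification `a ∅ = a`. -/
def appendNil (a : Prof C) : Iso (a.append nil) a :=
  ⟨finCongr (Nat.add_zero _), append_cases (fun i => by rw [get_inl]; rfl) (fun i => i.elim0)⟩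

/-- The order-preserving identification `f(a) f(b) = f(ab)`. -/
def mapAppend (f : C → D) (a b : Prof C) :
    Iso ((a.map f).append (b.map f)) ((a.append b).map f) :=
  ⟨Equiv.refl _, append_cases
    (fun i => (congrArg f (get_inl a b i)).trans (get_inl (a.map f) (b.map f) i).symm)
    (fun i => (congrArg f (get_inr a b i)).trans (get_inr (a.map f) (b.map f) i).symm)⟩

@[simp] theorem refl_toEquiv : (refl a).toEquiv = Equiv.refl _ := rfl
@[simp] theorem symm_toEquiv (σ : Iso a b) : σ.symm.toEquiv = σ.toEquiv.symm := rfl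
@[simp] theorem trans_toEquiv (σ : Iso a b) (τ : Iso b c) :
    (σ.trans τ).toEquiv = σ.toEquiv.trans τ.toEquiv := rfl
@[simp] theorem map_toEquiv (f : C → D) (σ : Iso a b) : (σ.map f).toEquiv = σ.toEquiv := rfl
@[simp] theorem append_inl (σ : Iso a b) (τ : Iso c d) (i) :
    (σ.append τ).toEquiv (inl a c i) = inl b d (σ.toEquiv i) := by
  simp [append]
@[simp] theorem append_inr (σ : Iso a b) (τ : Iso c d) (i) :
    (σ.append τ).toEquiv (inr a c i) = inr b d (τ.toEquiv i) := by
  simp [append]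
@[simp] theorem swap_inl (i) : (swap a b).toEquiv (inl a b i) = inr b a i := by
  simp [swap]
@[simp] theorem swap_inr (i) : (swap a b).toEquiv (inr a b i) = inl b a i := by
  simp [swap]
@[simp] theorem assoc_inl_inl (i) :
    (assoc a b c).toEquiv (inl _ c (inl a b i)) = inl _ _ i := rfl
@[simp] theorem assoc_inl_inr (i) :
    (assoc a b c).toEquiv (inl _ c (inr a b i)) = inr _ _ (inl _ _ i) := rfl
@[simp] theorem assoc_inr (i) :
    (assoc a b c).toEquiv (inr (a.append b) c i) = inr _ _ (inr _ _ i) :=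
  Fin.ext (Nat.add_assoc _ _ _)
@[simp] theorem nilAppend_inr (i) : (nilAppend a).toEquiv (inr nil a i) = i :=
  Fin.ext (Nat.zero_add _)
@[simp] theorem appendNil_inl (i) : (appendNil a).toEquiv (inl a nil i) = i := rfl
@[simp] theorem assoc_symm_inl (i) :
    (assoc a b c).toEquiv.symm (inl a _ i) = inl _ _ (inl _ _ i) := rfl
@[simp] theorem assoc_symm_inr_inl (i) :
    (assoc a b c).toEquiv.symm (inr a _ (inl b c i)) = inl _ _ (inr _ _ i) := rfl
@[simp] theorem assoc_symm_inr_inr (i) :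
    (assoc a b c).toEquiv.symm (inr a _ (inr b c i)) = inr _ _ i := by
  rw [Equiv.symm_apply_eq, assoc_inr]
@[simp] theorem appendNil_symm (i) : (appendNil a).toEquiv.symm i = inl a nil i := rfl
@[simp] theorem nilAppend_symm (i) : (nilAppend a).toEquiv.symm i = inr nil a i := by
  rw [Equiv.symm_apply_eq, nilAppend_inr]
@[simp] theorem mapAppend_inl (f : C → D) (a b : Prof C) (i) :
    (mapAppend f a b).toEquiv (inl (a.map f) (b.map f) i) = inl a b i := rfl
@[simp] theorem mapAppend_inr (f : C → D) (a b : Prof C) (i) :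
    (mapAppend f a b).toEquiv (inr (a.map f) (b.map f) i) = inr a b i := rfl
@[simp] theorem mapAppend_symm_inl (f : C → D) (a b : Prof C) (i) :
    (mapAppend f a b).toEquiv.symm (inl a b i) = inl (a.map f) (b.map f) i := rfl
@[simp] theorem mapAppend_symm_inr (f : C → D) (a b : Prof C) (i) :
    (mapAppend f a b).toEquiv.symm (inr a b i) = inr (a.map f) (b.map f) i := rfl

/-- `b(ac) ≅ a(bc)`. -/
def leftComm (a b c : Prof C) : Iso (b.append (a.append c)) (a.append (b.append c)) :=
  ((assoc b a c).symm.trans ((swap b a).append (refl c))).trans (assoc a b c)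

@[simp] theorem leftComm_inl (i) :
    (leftComm a b c).toEquiv (inl b _ i) = inr _ _ (inl _ _ i) := by
  simp [leftComm]
@[simp] theorem leftComm_inr_inl (i) :
    (leftComm a b c).toEquiv (inr b _ (inl a c i)) = inl _ _ i := by
  simp [leftComm]
@[simp] theorem leftComm_inr_inr (i) :
    (leftComm a b c).toEquiv (inr b _ (inr a c i)) = inr _ _ (inr _ _ i) := by
  simp [leftComm]

/-- `(ab)(cd) ≅ (ac)(bd)`. -/
def middle (a b c d : Prof C) :
    Iso ((a.append b).append (c.append d)) ((a.append c).append (b.append d)) :=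
  (assoc a b _).trans (((refl a).append (leftComm c b d)).trans (assoc a c _).symm)

@[simp] theorem middle_inl_inl (i) :
    (middle a b c d).toEquiv (inl _ (c.append d) (inl a b i)) = inl _ _ (inl _ _ i) := by
  simp [middle]
@[simp] theorem middle_inl_inr (i) :
    (middle a b c d).toEquiv (inl _ (c.append d) (inr a b i)) = inr _ _ (inl _ _ i) := by
  simp [middle]
@[simp] theorem middle_inr_inl (i) :
    (middle a b c d).toEquiv (inr (a.append b) _ (inl c d i)) = inl _ _ (inr _ _ i) := by
  simp [middle]
@[simp] theorem middle_inr_inr (i) :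
    (middle a b c d).toEquiv (inr (a.append b) _ (inr c d i)) = inr _ _ (inr _ _ i) := by
  simp [middle]

theorem ext_fun {σ τ : Iso a b} (h : ∀ i, σ.toEquiv i = τ.toEquiv i) : σ = τ :=
  Iso.ext (Equiv.ext h)

theorem self_trans_symm (σ : Iso a b) : σ.trans σ.symm = refl a :=
  ext_fun fun i => σ.toEquiv.symm_apply_apply i

theorem symm_trans_self (σ : Iso a b) : σ.symm.trans σ = refl b :=
  ext_fun fun i => σ.toEquiv.apply_symm_apply i

theorem append_ext {σ τ : Iso (a.append b) c}
    (hl : ∀ i, σ.toEquiv (inl a b i) = τ.toEquiv (inl a b i))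
    (hr : ∀ i, σ.toEquiv (inr a b i) = τ.toEquiv (inr a b i)) : σ = τ :=
  ext_fun (append_cases hl hr)

/-- The empty list is preserved by functions on entries. -/
def mapNil (f : C → D) : Iso (nil : Prof D) ((nil : Prof C).map f) :=
  ⟨Equiv.refl _, fun i => i.elim0⟩

theorem map_assoc (f : C → D) (a b c : Prof C) :
    (((mapAppend f a b).append (refl (c.map f))).trans
        (mapAppend f (a.append b) c)).trans ((assoc a b c).map f)
      = (assoc (a.map f) (b.map f) (c.map f)).trans
        (((refl (a.map f)).append (mapAppend f b c)).trans (mapAppend f a (b.append c))) := by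
  refine append_ext (append_cases (fun i => ?_) (fun i => ?_)) (fun i => ?_)
  · simp
    rfl
  · simp
    rfl
  · simp
    exact assoc_inr (a := a) (b := b) (c := c) i

theorem map_nilAppend (f : C → D) (a : Prof C) :
    (((mapNil f).append (refl (a.map f))).trans (mapAppend f nil a)).trans ((nilAppend a).map f)
      = nilAppend (a.map f) := by
  refine append_ext (fun i => i.elim0) (fun i => ?_)
  simp
  exact nilAppend_inr (a := a) i

theorem map_appendNil (f : C → D) (a : Prof C) :
    (((refl (a.map f)).append (mapNil f)).trans (mapAppend f a nil)).trans ((appendNil a).map f)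
      = appendNil (a.map f) := by
  exact append_ext (fun i => by simp; rfl) (fun i => i.elim0)

theorem map_append (σ : Iso a b) (τ : Iso c d) (f : C → D) :
    ((σ.map f).append (τ.map f)).trans (mapAppend f b d)
      = (mapAppend f a c).trans ((σ.append τ).map f) := by
  refine append_ext (fun i => ?_) (fun i => ?_)
  · exact (append_inl (σ.map f) (τ.map f) i).trans (append_inl σ τ i).symm
  · exact (append_inr (σ.map f) (τ.map f) i).trans (append_inr σ τ i).symm

theorem map_swap (f : C → D) (a b : Prof C) :
    (mapAppend f a b).trans ((swap a b).map f)
      = (swap (a.map f) (b.map f)).trans (mapAppend f b a) := by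
  refine append_ext (fun i => ?_) (fun i => ?_)
  · exact (swap_inl (a := a) (b := b) i).trans (swap_inl (a := a.map f) (b := b.map f) i).symm
  · exact (swap_inr (a := a) (b := b) i).trans (swap_inr (a := a.map f) (b := b.map f) i).symm

end Iso

/-- The concatenation `⟨P_1, …, P_n⟩` of a list of lists. -/
def flat : {n : ℕ} → (Fin n → Prof C) → Prof C
  | 0, _ => nil
  | _ + 1, P => (P 0).append (flat fun i => P i.succ)

/-- Positions of a concatenation of lists: `idx ⟨i, j⟩` is the position of the `j`-th entry of
the `i`-th list. -/
def idx : {n : ℕ} → (P : Fin n → Prof C) → (Σ i, Fin (P i).len) ≃ Fin (flat P).len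
  | 0, _ => ⟨fun x => x.1.elim0, fun x => Fin.elim0 x, fun x => x.1.elim0, fun x => Fin.elim0 x⟩
  | _ + 1, P =>
    (show (Σ i, Fin (P i).len) ≃ Fin (P 0).len ⊕ (Σ i, Fin (P (Fin.succ i)).len) from
      { toFun := fun x => Fin.cases (motive := fun i => Fin (P i).len →
            Fin (P 0).len ⊕ (Σ i, Fin (P (Fin.succ i)).len))
            Sum.inl (fun i j => Sum.inr ⟨i, j⟩) x.1 x.2
        invFun := Sum.elim (fun j => ⟨0, j⟩) (fun x => ⟨x.1.succ, x.2⟩)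
        left_inv := by
          rintro ⟨i, j⟩
          refine Fin.cases (fun j => rfl) (fun i j => rfl) i j
        right_inv := by rintro (j | ⟨i, j⟩) <;> rfl }).trans
      ((Equiv.sumCongr (Equiv.refl _) (idx fun i => P i.succ)).trans (pos _ _))

@[simp] theorem idx_zero {n : ℕ} (P : Fin (n + 1) → Prof C) (j : Fin (P 0).len) :
    idx P ⟨0, j⟩ = inl _ _ j := rfl

@[simp] theorem idx_succ {n : ℕ} (P : Fin (n + 1) → Prof C) (i : Fin n)
    (j : Fin (P i.succ).len) :
    idx P ⟨i.succ, j⟩ = inr _ _ (idx (fun i => P i.succ) ⟨i, j⟩) := rfl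

@[simp] theorem get_idx : {n : ℕ} → (P : Fin n → Prof C) → (i : Fin n) → (j : Fin (P i).len) →
    (flat P).get (idx P ⟨i, j⟩) = (P i).get j
  | 0, _, i, _ => i.elim0
  | _ + 1, P, i, j => by
    revert j
    refine Fin.cases (fun j => ?_) (fun i j => ?_) i
    · exact get_inl _ _ _
    · exact (get_inr _ _ _).trans (get_idx (fun i => P i.succ) i j)

theorem flat_ext {n : ℕ} {P : Fin n → Prof C} {c : Prof C} {σ τ : Iso (flat P) c}
    (h : ∀ i j, σ.toEquiv (idx P ⟨i, j⟩) = τ.toEquiv (idx P ⟨i, j⟩)) : σ = τ :=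
  Iso.ext_fun fun k => by
    obtain ⟨⟨i, j⟩, rfl⟩ := (idx P).surjective k
    exact h i j

/-- A bijection of double positions induces a bijection of concatenated lists. -/
def flatIso {n n' : ℕ} {P : Fin n → Prof C} {P' : Fin n' → Prof C}
    (e : (Σ i, Fin (P i).len) ≃ (Σ i, Fin (P' i).len))
    (h : ∀ i j, (P' (e ⟨i, j⟩).1).get (e ⟨i, j⟩).2 = (P i).get j) : Iso (flat P) (flat P') :=
  ⟨(idx P).symm.trans (e.trans (idx P')), by
    intro k
    obtain ⟨⟨i, j⟩, rfl⟩ := (idx _).surjective k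
    rw [get_idx, ← h, Equiv.trans_apply, Equiv.symm_apply_apply]
    exact get_idx P' _ _⟩

theorem flatIso_idx {n n' : ℕ} {P : Fin n → Prof C} {P' : Fin n' → Prof C}
    (e : (Σ i, Fin (P i).len) ≃ (Σ i, Fin (P' i).len)) (h) (i j) :
    (flatIso (P := P) (P' := P') e h).toEquiv (idx P ⟨i, j⟩) = idx P' (e ⟨i, j⟩) := by
  simp [flatIso]

/-- Isomorphisms of lists induce an isomorphism of concatenations. -/
def flatCongr {n : ℕ} {P P' : Fin n → Prof C} (σ : ∀ i, Iso (P i) (P' i)) :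
    Iso (flat P) (flat P') :=
  flatIso (Equiv.sigmaCongrRight fun i => (σ i).toEquiv) fun i j => (σ i).get_eq j

@[simp] theorem flatCongr_idx {n : ℕ} {P P' : Fin n → Prof C} (σ : ∀ i, Iso (P i) (P' i))
    (i j) : (flatCongr σ).toEquiv (idx P ⟨i, j⟩) = idx P' ⟨i, (σ i).toEquiv j⟩ :=
  flatIso_idx _ _ _ _

/-- Block permutations. -/
def flatPerm {n : ℕ} (τ : Equiv.Perm (Fin n)) (P : Fin n → Prof C) :
    Iso (flat fun i => P (τ i)) (flat P) :=
  flatIso (Equiv.sigmaCongrLeft (β := fun i => Fin (P i).len) τ) fun _ _ => rfl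

@[simp] theorem flatPerm_idx {n : ℕ} (τ : Equiv.Perm (Fin n)) (P : Fin n → Prof C) (i j) :
    (flatPerm τ P).toEquiv (idx (fun i => P (τ i)) ⟨i, j⟩) = idx P ⟨τ i, j⟩ :=
  flatIso_idx _ _ _ _

theorem flat_append_ext {n n' : ℕ} {P : Fin n → Prof C} {P' : Fin n' → Prof C} {c : Prof C}
    {σ τ : Iso ((flat P).append (flat P')) c}
    (hl : ∀ i j, σ.toEquiv (inl _ _ (idx P ⟨i, j⟩)) = τ.toEquiv (inl _ _ (idx P ⟨i, j⟩)))
    (hr : ∀ i j, σ.toEquiv (inr _ _ (idx P' ⟨i, j⟩)) = τ.toEquiv (inr _ _ (idx P' ⟨i, j⟩))) :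
    σ = τ := by
  refine Iso.append_ext (fun k => ?_) (fun k => ?_) <;>
    obtain ⟨⟨i, j⟩, rfl⟩ := (idx _).surjective k
  exacts [hl i j, hr i j]

/-- A permutation of `{1, …, n}` shifted by one. -/
def consPerm {n : ℕ} (τ : Equiv.Perm (Fin n)) : Equiv.Perm (Fin (n + 1)) where
  toFun := Fin.cases 0 fun i => (τ i).succ
  invFun := Fin.cases 0 fun i => (τ.symm i).succ
  left_inv := by intro i; refine Fin.cases rfl (fun i => ?_) i; simp
  right_inv := by intro i; refine Fin.cases rfl (fun i => ?_) i; simp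

/-- The exchange of the first two elements. -/
def swapPerm (n : ℕ) : Equiv.Perm (Fin (n + 2)) where
  toFun := Fin.cases 1 (Fin.cases 0 fun i => i.succ.succ)
  invFun := Fin.cases 1 (Fin.cases 0 fun i => i.succ.succ)
  left_inv := by
    intro i; refine Fin.cases rfl (fun i => ?_) i; refine Fin.cases rfl (fun i => rfl) i
  right_inv := by
    intro i; refine Fin.cases rfl (fun i => ?_) i; refine Fin.cases rfl (fun i => rfl) i

theorem swap_zero_one (n : ℕ) :
    Equiv.swap (0 : Fin (n + 1)).castSucc (0 : Fin (n + 1)).succ = swapPerm n := by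
  ext i
  refine Fin.cases ?_ (fun i => ?_) i
  · rw [Fin.castSucc_zero, Equiv.swap_apply_left]; rfl
  · refine Fin.cases ?_ (fun i => ?_) i
    · rw [Equiv.swap_apply_right]; rfl
    · rw [Equiv.swap_apply_of_ne_of_ne]
      · rfl
      · exact Fin.succ_ne_zero _
      · intro h; exact Fin.succ_ne_zero _ (Fin.succ_injective _ h)

theorem swap_succ {n : ℕ} (i : Fin n) :
    Equiv.swap i.succ.castSucc i.succ.succ = consPerm (Equiv.swap i.castSucc i.succ) := by
  refine Equiv.ext fun j => Fin.cases ?_ (fun j => ?_) j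
  · rw [Equiv.swap_apply_of_ne_of_ne]
    · rfl
    · exact fun h => Fin.succ_ne_zero _ (show i.castSucc.succ = 0 from h.symm)
    · exact (Fin.succ_ne_zero _).symm
  · change Equiv.swap i.castSucc.succ i.succ.succ j.succ = (Equiv.swap i.castSucc i.succ j).succ
    exact ((Fin.succ_injective _).map_swap _ _ _).symm

theorem flatPerm_cons {n : ℕ} (τ : Equiv.Perm (Fin n)) (P : Fin (n + 1) → Prof C) :
    (Iso.refl (P 0)).append (flatPerm τ fun i => P i.succ) = flatPerm (consPerm τ) P := by
  refine flat_ext (P := fun i => P (consPerm τ i)) fun i =>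
    Fin.cases (fun j => ?_) (fun i j => ?_) i
  · exact (Iso.append_inl _ _ _).trans (flatPerm_idx (consPerm τ) P 0 j).symm
  · refine Eq.trans ?_ (flatPerm_idx (consPerm τ) P i.succ j).symm
    have h : ∀ j : Fin (P (τ i).succ).len, ((Iso.refl (P 0)).append
        (flatPerm τ fun i => P i.succ)).toEquiv (inr _ _ (idx _ ⟨i, j⟩))
        = inr _ _ (idx _ ⟨τ i, j⟩) := fun j => by
      rw [Iso.append_inr, flatPerm_idx τ (fun i => P i.succ) i j]
    exact h j

theorem flatPerm_swap {n : ℕ} (P : Fin (n + 2) → Prof C) :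
    Iso.leftComm (P 0) (P 1) (flat fun i => P i.succ.succ) = flatPerm (swapPerm n) P := by
  refine flat_ext (P := fun i => P (swapPerm n i)) fun i => Fin.cases (fun j => ?_)
    (fun i => Fin.cases (fun j => ?_) (fun i j => ?_) i) i
  · exact (Iso.leftComm_inl _).trans (flatPerm_idx (swapPerm n) P 0 j).symm
  · exact (Iso.leftComm_inr_inl _).trans (flatPerm_idx (swapPerm n) P 1 j).symm
  · exact (Iso.leftComm_inr_inr _).trans (flatPerm_idx (swapPerm n) P i.succ.succ j).symm

theorem flatPerm_mul {n : ℕ} (σ τ : Equiv.Perm (Fin n)) (P : Fin n → Prof C) :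
    (flatPerm τ fun i => P (σ i)).trans (flatPerm σ P) = flatPerm (σ * τ) P := by
  refine flat_ext (P := fun i => P (σ (τ i))) fun i j => ?_
  rw [Iso.trans_toEquiv, Equiv.trans_apply, flatPerm_idx τ (fun i => P (σ i)), flatPerm_idx]
  exact (flatPerm_idx (σ * τ) P i j).symm

theorem flatPerm_one {n : ℕ} (P : Fin n → Prof C) : Iso.refl (flat P) = flatPerm 1 P :=
  flat_ext fun i j => (flatPerm_idx 1 P i j).symm

/-- `⟨P_i⟩⟨P'_i⟩ ≅ ⟨P_i P'_i⟩`. -/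
def flatAppend {n : ℕ} (P P' : Fin n → Prof C) :
    Iso ((flat P).append (flat P')) (flat fun i => (P i).append (P' i)) :=
  ⟨(pos _ _).symm.trans ((Equiv.sumCongr (idx P).symm (idx P').symm).trans
    ((show (Σ i, Fin (P i).len) ⊕ (Σ i, Fin (P' i).len) ≃
        (Σ i, Fin (P i).len ⊕ Fin (P' i).len) from
      ⟨Sum.elim (fun x => ⟨x.1, Sum.inl x.2⟩) (fun x => ⟨x.1, Sum.inr x.2⟩),
        fun x => match x with
          | ⟨i, Sum.inl j⟩ => Sum.inl ⟨i, j⟩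
          | ⟨i, Sum.inr j⟩ => Sum.inr ⟨i, j⟩,
        by rintro (x | x) <;> rfl, by rintro ⟨i, (x | x)⟩ <;> rfl⟩).trans
      ((Equiv.sigmaCongrRight fun _ => pos _ _).trans
      (idx fun i => (P i).append (P' i))))), by
    refine append_cases (fun k => ?_) (fun k => ?_) <;>
      obtain ⟨⟨i, j⟩, rfl⟩ := (idx _).surjective k <;> simp⟩

@[simp] theorem flatAppend_inl {n : ℕ} (P P' : Fin n → Prof C) (i j) :
    (flatAppend P P').toEquiv (inl _ _ (idx P ⟨i, j⟩))
      = idx (fun i => (P i).append (P' i)) ⟨i, inl _ _ j⟩ := by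
  simp [flatAppend]

@[simp] theorem flatAppend_inr {n : ℕ} (P P' : Fin n → Prof C) (i j) :
    (flatAppend P P').toEquiv (inr _ _ (idx P' ⟨i, j⟩))
      = idx (fun i => (P i).append (P' i)) ⟨i, inr _ _ j⟩ := by
  simp [flatAppend]

theorem flatAppend_succ {n : ℕ} (P P' : Fin (n + 1) → Prof C) :
    (Iso.middle (P 0) (flat fun i => P i.succ) (P' 0) (flat fun i => P' i.succ)).trans
      ((Iso.refl _).append (flatAppend (fun i => P i.succ) (fun i => P' i.succ)))
      = flatAppend P P' := by
  refine flat_append_ext (P := P) (P' := P') (fun i j => ?_) (fun i j => ?_)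
  · refine Eq.trans ?_ (flatAppend_inl P P' i j).symm
    revert j
    refine Fin.cases (fun j => ?_) (fun i j => ?_) i
    · have h : ((Iso.middle (P 0) (flat fun i => P i.succ) (P' 0)
          (flat fun i => P' i.succ)).trans ((Iso.refl _).append (flatAppend (fun i => P i.succ)
            (fun i => P' i.succ)))).toEquiv (inl _ _ (inl _ _ j)) = inl _ _ (inl _ _ j) := by simp
      exact h
    · have h : ((Iso.middle (P 0) (flat fun i => P i.succ) (P' 0)
          (flat fun i => P' i.succ)).trans ((Iso.refl _).append (flatAppend (fun i => P i.succ)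
            (fun i => P' i.succ)))).toEquiv (inl _ _ (inr _ _ (idx _ ⟨i, j⟩)))
          = inr _ _ (idx _ ⟨i, inl _ _ j⟩) := by simp
      exact h
  · refine Eq.trans ?_ (flatAppend_inr P P' i j).symm
    revert j
    refine Fin.cases (fun j => ?_) (fun i j => ?_) i
    · have h : ((Iso.middle (P 0) (flat fun i => P i.succ) (P' 0)
          (flat fun i => P' i.succ)).trans ((Iso.refl _).append (flatAppend (fun i => P i.succ)
            (fun i => P' i.succ)))).toEquiv (inr _ _ (inl _ _ j)) = inl _ _ (inr _ _ j) := by simp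
      exact h
    · have h : ((Iso.middle (P 0) (flat fun i => P i.succ) (P' 0)
          (flat fun i => P' i.succ)).trans ((Iso.refl _).append (flatAppend (fun i => P i.succ)
            (fun i => P' i.succ)))).toEquiv (inr _ _ (inr _ _ (idx _ ⟨i, j⟩)))
          = inr _ _ (idx _ ⟨i, inr _ _ j⟩) := by simp
      exact h

/-- Concatenation of two consecutive families of lists. -/
def flatAdd {n n' : ℕ} (P : Fin (n + n') → Prof C) :
    Iso ((flat fun i => P (Fin.castAdd n' i)).append (flat fun i => P (Fin.natAdd n i)))
      (flat P) :=
  ⟨(pos _ _).symm.trans ((Equiv.sumCongr (idx _).symm (idx _).symm).trans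
    ((show (Σ i : Fin n, Fin (P (Fin.castAdd n' i)).len) ⊕
        (Σ i : Fin n', Fin (P (Fin.natAdd n i)).len) ≃
        (Σ s : Fin n ⊕ Fin n', Fin (P (finSumFinEquiv s)).len) from
      ⟨Sum.elim (fun x => ⟨Sum.inl x.1, x.2⟩) (fun x => ⟨Sum.inr x.1, x.2⟩),
        fun x => match x with
          | ⟨Sum.inl i, j⟩ => Sum.inl ⟨i, j⟩
          | ⟨Sum.inr i, j⟩ => Sum.inr ⟨i, j⟩,
        by rintro (x | x) <;> rfl, by rintro ⟨(x | x), j⟩ <;> rfl⟩).trans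
      ((Equiv.sigmaCongrLeft (β := fun i => Fin (P i).len) finSumFinEquiv).trans (idx P)))), by
    refine append_cases (fun k => ?_) (fun k => ?_) <;>
      obtain ⟨⟨i, j⟩, rfl⟩ := (idx _).surjective k <;> simp⟩

@[simp] theorem flatAdd_inl {n n' : ℕ} (P : Fin (n + n') → Prof C) (i j) :
    (flatAdd P).toEquiv (inl _ _ (idx (fun i => P (Fin.castAdd n' i)) ⟨i, j⟩))
      = idx P ⟨Fin.castAdd n' i, j⟩ := by
  simp [flatAdd]

@[simp] theorem flatAdd_inr {n n' : ℕ} (P : Fin (n + n') → Prof C) (i j) :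
    (flatAdd P).toEquiv (inr _ _ (idx (fun i => P (Fin.natAdd n i)) ⟨i, j⟩))
      = idx P ⟨Fin.natAdd n i, j⟩ := by
  simp [flatAdd]

/-- Concatenation of a family of lists indexed by the positions of `a b`. -/
def flatPos {X : Type u} (a b : Prof X) (P : Fin (a.append b).len → Prof C) :
    Iso ((flat fun i => P (inl a b i)).append (flat fun i => P (inr a b i))) (flat P) :=
  flatAdd (n := a.len) (n' := b.len) P

@[simp] theorem flatPos_inl {X : Type u} (a b : Prof X) (P : Fin (a.append b).len → Prof C)
    (i j) : (flatPos a b P).toEquiv (inl _ _ (idx (fun i => P (inl a b i)) ⟨i, j⟩))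
      = idx P ⟨inl a b i, j⟩ :=
  flatAdd_inl (n := a.len) (n' := b.len) P i j

@[simp] theorem flatPos_inr {X : Type u} (a b : Prof X) (P : Fin (a.append b).len → Prof C)
    (i j) : (flatPos a b P).toEquiv (inr _ _ (idx (fun i => P (inr a b i)) ⟨i, j⟩))
      = idx P ⟨inr a b i, j⟩ :=
  flatAdd_inr (n := a.len) (n' := b.len) P i j

/-- The last list of a family split off. -/
def flatSnoc {n : ℕ} (P : Fin (n + 1) → Prof C) :
    Iso ((flat fun i => P i.castSucc).append (P (Fin.last n))) (flat P) :=
  ((Iso.refl _).append (Iso.appendNil _).symm).trans (flatAdd (n := n) (n' := 1) P)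

@[simp] theorem flatSnoc_inl {n : ℕ} (P : Fin (n + 1) → Prof C) (i j) :
    (flatSnoc P).toEquiv (inl _ _ (idx (fun i => P i.castSucc) ⟨i, j⟩))
      = idx P ⟨i.castSucc, j⟩ := by
  refine Eq.trans ?_ (flatAdd_inl (n := n) (n' := 1) P i j)
  exact congrArg (flatAdd (n := n) (n' := 1) P).toEquiv (Iso.append_inl _ _ _)

@[simp] theorem flatSnoc_inr {n : ℕ} (P : Fin (n + 1) → Prof C) (j) :
    (flatSnoc P).toEquiv (inr _ _ j) = idx P ⟨Fin.last n, j⟩ := by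
  refine Eq.trans ?_ (flatAdd_inr (n := n) (n' := 1) P 0 j)
  exact congrArg (flatAdd (n := n) (n' := 1) P).toEquiv (Iso.append_inr _ _ _)

theorem flatSnoc_zero (P : Fin 1 → Prof C) :
    (Iso.appendNil (P 0)).symm = (Iso.nilAppend (P 0)).symm.trans (flatSnoc P) :=
  Iso.ext_fun fun j => by
    refine Eq.trans ?_ (congrArg (flatSnoc P).toEquiv (Iso.nilAppend_symm (a := P 0) j)).symm
    exact (flatSnoc_inr P j).symm

theorem flatSnoc_succ {n : ℕ} (P : Fin (n + 2) → Prof C) :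
    (Iso.assoc (P 0) (flat fun i : Fin n => P i.succ.castSucc) (P (Fin.last (n + 1)))).trans
      ((Iso.refl _).append (flatSnoc fun i => P i.succ)) = flatSnoc P := by
  refine Iso.append_ext (a := flat fun i : Fin (n + 1) => P i.castSucc) (fun k => ?_) (fun j => ?_)
  · obtain ⟨⟨i, j⟩, rfl⟩ := (idx _).surjective k
    refine Eq.trans ?_ (flatSnoc_inl P i j).symm
    revert j
    refine Fin.cases (fun j => ?_) (fun i j => ?_) i
    · have h : ∀ j : Fin (P 0).len, ((Iso.assoc (P 0)
          (flat fun i : Fin n => P i.succ.castSucc)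
          (P (Fin.last (n + 1)))).trans ((Iso.refl _).append
            (flatSnoc fun i => P i.succ))).toEquiv (inl _ _ (inl _ _ j)) = inl _ _ j :=
        fun j => by simp
      exact h j
    · have h : ((Iso.assoc (P 0) (flat fun i : Fin n => P i.succ.castSucc)
          (P (Fin.last (n + 1)))).trans ((Iso.refl _).append
            (flatSnoc fun i => P i.succ))).toEquiv
            (inl _ _ (inr _ _ (idx (fun i : Fin n => P i.succ.castSucc) ⟨i, j⟩)))
            = inr _ _ (idx (fun i => P i.succ) ⟨i.castSucc, j⟩) := by
        simp
        exact congrArg _ (flatSnoc_inl (fun i => P i.succ) i j)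
      exact h
  · refine Eq.trans ?_ (flatSnoc_inr P j).symm
    have h : ((Iso.assoc (P 0) (flat fun i : Fin n => P i.succ.castSucc)
          (P (Fin.last (n + 1)))).trans ((Iso.refl _).append
            (flatSnoc fun i => P i.succ))).toEquiv (inr _ _ j)
            = inr _ _ (idx (fun i => P i.succ) ⟨Fin.last n, j⟩) := by
      simp
      exact congrArg _ (flatSnoc_inr (fun i => P i.succ) j)
    exact h

theorem flatAdd_zero {n : ℕ} (P : Fin (n + 0) → Prof C) :
    Iso.refl (flat P) = (Iso.appendNil (flat P)).symm.trans (flatAdd P) := by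
  refine flat_ext (P := P) fun i j => ?_
  exact (flatAdd_inl (n := n) (n' := 0) P i j).symm

theorem flatAdd_succ {n n' : ℕ} (P : Fin (n + (n' + 1)) → Prof C) :
    ((flatAdd fun i : Fin (n + n') => P i.castSucc).append (Iso.refl (P (Fin.last (n + n'))))).trans
      (flatSnoc (n := n + n') P)
    = (Iso.assoc _ _ _).trans
      (((Iso.refl _).append (flatSnoc fun i => P (Fin.natAdd n i))).trans (flatAdd P)) := by
  refine Iso.append_ext (fun k => ?_) (fun j => ?_)
  · revert k
    refine append_cases (fun k => ?_) (fun k => ?_) <;>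
      obtain ⟨⟨i, j⟩, rfl⟩ := (idx _).surjective k
    · have h1 : (((flatAdd fun i : Fin (n + n') => P i.castSucc).append
          (Iso.refl (P (Fin.last (n + n'))))).trans (flatSnoc (n := n + n') P)).toEquiv
          (inl _ _ (inl _ _ (idx _ ⟨i, j⟩))) = idx P ⟨(Fin.castAdd n' i).castSucc, j⟩ := by
        simp only [Iso.trans_toEquiv, Equiv.trans_apply, Iso.append_inl]
        rw [flatAdd_inl (fun i : Fin (n + n') => P i.castSucc) i j]
        exact flatSnoc_inl (n := n + n') P _ j
      have h2 : ∀ j : Fin (P (Fin.castAdd (n' + 1) i)).len,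
          ((Iso.assoc (flat fun i => P (Fin.castAdd (n' + 1) i))
            (flat fun i => P (Fin.natAdd n i.castSucc)) (P (Fin.natAdd n (Fin.last n')))).trans
          (((Iso.refl _).append (flatSnoc fun i => P (Fin.natAdd n i))).trans
            (flatAdd P))).toEquiv (inl _ _ (inl _ _ (idx _ ⟨i, j⟩)))
            = idx P ⟨Fin.castAdd (n' + 1) i, j⟩ := fun j => by
        simp only [Iso.trans_toEquiv, Equiv.trans_apply, Iso.append_inl, Iso.assoc_inl_inl,
          Iso.refl_toEquiv, Equiv.refl_apply]
        exact flatAdd_inl P i j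
      exact h1.trans (h2 j).symm
    · have h1 : (((flatAdd fun i : Fin (n + n') => P i.castSucc).append
          (Iso.refl (P (Fin.last (n + n'))))).trans (flatSnoc (n := n + n') P)).toEquiv
          (inl _ _ (inr _ _ (idx _ ⟨i, j⟩))) = idx P ⟨(Fin.natAdd n i).castSucc, j⟩ := by
        simp only [Iso.trans_toEquiv, Equiv.trans_apply, Iso.append_inl]
        rw [flatAdd_inr (fun i : Fin (n + n') => P i.castSucc) i j]
        exact flatSnoc_inl (n := n + n') P _ j
      have h2 : ∀ j : Fin (P (Fin.natAdd n i.castSucc)).len,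
          ((Iso.assoc (flat fun i => P (Fin.castAdd (n' + 1) i))
            (flat fun i => P (Fin.natAdd n i.castSucc)) (P (Fin.natAdd n (Fin.last n')))).trans
          (((Iso.refl _).append (flatSnoc fun i => P (Fin.natAdd n i))).trans
            (flatAdd P))).toEquiv (inl _ _ (inr _ _ (idx _ ⟨i, j⟩)))
            = idx P ⟨Fin.natAdd n i.castSucc, j⟩ := fun j => by
        simp only [Iso.trans_toEquiv, Equiv.trans_apply, Iso.append_inr, Iso.assoc_inl_inr]
        rw [flatSnoc_inl (fun i => P (Fin.natAdd n i)) i j]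
        exact flatAdd_inr P i.castSucc j
      exact h1.trans (h2 j).symm
  · have h1 : (((flatAdd fun i : Fin (n + n') => P i.castSucc).append
        (Iso.refl (P (Fin.last (n + n'))))).trans (flatSnoc (n := n + n') P)).toEquiv
        (inr _ _ j) = idx P ⟨Fin.last (n + n'), j⟩ := by
      simp only [Iso.trans_toEquiv, Equiv.trans_apply, Iso.append_inr]
      exact flatSnoc_inr (n := n + n') P j
    have h2 : ∀ j : Fin (P (Fin.natAdd n (Fin.last n'))).len,
        ((Iso.assoc (flat fun i => P (Fin.castAdd (n' + 1) i))
          (flat fun i => P (Fin.natAdd n i.castSucc)) (P (Fin.natAdd n (Fin.last n')))).trans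
        (((Iso.refl _).append (flatSnoc fun i => P (Fin.natAdd n i))).trans
          (flatAdd P))).toEquiv (inr _ _ j)
          = idx P ⟨Fin.natAdd n (Fin.last n'), j⟩ := fun j => by
      simp only [Iso.trans_toEquiv, Equiv.trans_apply, Iso.append_inr, Iso.assoc_inr]
      rw [flatSnoc_inr (fun i => P (Fin.natAdd n i)) j]
      exact flatAdd_inr P (Fin.last n') j
    exact h1.trans (h2 j).symm

/-- Concatenation commutes with functions on entries. -/
def mapFlat (f : C → D) {n : ℕ} (P : Fin n → Prof C) :
    Iso (flat fun i => (P i).map f) ((flat P).map f) :=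
  ⟨(idx fun i => (P i).map f).symm.trans (idx P), by
    intro k
    obtain ⟨⟨i, j⟩, rfl⟩ := (idx _).surjective k
    rw [get_idx]
    simp⟩

@[simp] theorem mapFlat_idx (f : C → D) {n : ℕ} (P : Fin n → Prof C) (i j) :
    (mapFlat f P).toEquiv (idx (fun i => (P i).map f) ⟨i, j⟩) = idx P ⟨i, j⟩ := by
  simp [mapFlat]

theorem mapFlat_succ (f : C → D) {n : ℕ} (P : Fin (n + 1) → Prof C) :
    ((Iso.refl ((P 0).map f)).append (mapFlat f fun i => P i.succ)).trans
      (Iso.mapAppend f (P 0) (flat fun i => P i.succ)) = mapFlat f P := by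
  refine flat_ext (P := fun i => (P i).map f) fun i => Fin.cases (fun j => ?_) (fun i j => ?_) i
  · refine Eq.trans ?_ (mapFlat_idx f P 0 j).symm
    exact congrArg (Iso.mapAppend f _ _).toEquiv (Iso.append_inl _ _ _)
  · refine Eq.trans ?_ (mapFlat_idx f P i.succ j).symm
    have h : (((Iso.refl ((P 0).map f)).append (mapFlat f fun i => P i.succ)).trans
      (Iso.mapAppend f (P 0) (flat fun i => P i.succ))).toEquiv (inr _ _ (idx _ ⟨i, j⟩))
      = inr _ _ (idx _ ⟨i, j⟩) := by
        rw [Iso.trans_toEquiv, Equiv.trans_apply, Iso.append_inr,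
          mapFlat_idx f (fun i => P i.succ) i j]
        rfl
    exact h

/-- The interchange `⟨⟨x_{ij}⟩_j⟩_i ≅ ⟨⟨x_{ij}⟩_i⟩_j`. -/
def interchange {n p : ℕ} (x : Fin n → Fin p → C) :
    Iso (flat fun i => (⟨p, x i⟩ : Prof C)) (flat fun j => (⟨n, fun i => x i j⟩ : Prof C)) :=
  ⟨(idx _).symm.trans
    ((show (Σ _ : Fin n, Fin p) ≃ (Σ _ : Fin p, Fin n) from
      ⟨fun y => ⟨y.2, y.1⟩, fun y => ⟨y.2, y.1⟩, fun _ => rfl, fun _ => rfl⟩).trans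
      (idx fun j => (⟨n, fun i => x i j⟩ : Prof C))), by
    intro k
    obtain ⟨⟨i, j⟩, rfl⟩ := (idx _).surjective k
    rw [get_idx, Equiv.trans_apply, Equiv.symm_apply_apply]
    exact get_idx (fun j => (⟨n, fun i => x i j⟩ : Prof C)) j i⟩

@[simp] theorem interchange_idx {n p : ℕ} (x : Fin n → Fin p → C) (i : Fin n) (j : Fin p) :
    (interchange x).toEquiv (idx (fun i => (⟨p, x i⟩ : Prof C)) ⟨i, j⟩)
      = idx (fun j => (⟨n, fun i => x i j⟩ : Prof C)) ⟨j, i⟩ := by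
  simp [interchange]

theorem mapFlat_interchange (f : C → D) {n p : ℕ} (x : Fin n → Fin p → C) :
    (mapFlat f fun i => (⟨p, x i⟩ : Prof C)).trans ((interchange x).map f)
      = (interchange fun i j => f (x i j)).trans
        (mapFlat f fun j => (⟨n, fun i => x i j⟩ : Prof C)) := by
  refine flat_ext fun i j => ?_
  have h1 := congrArg (interchange x).toEquiv (mapFlat_idx f (fun i => (⟨p, x i⟩ : Prof C)) i j)
  have h2 := congrArg (mapFlat f fun j => (⟨n, fun i => x i j⟩ : Prof C)).toEquiv
    (interchange_idx (fun i j => f (x i j)) i j)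
  exact h1.trans ((interchange_idx x i j).trans ((mapFlat_idx f (fun j => (⟨n, fun i => x i j⟩ : Prof C))
    j i).symm.trans h2.symm))

theorem mapFlat_interchange_symm (f : C → D) {n p : ℕ} (x : Fin n → Fin p → C) :
    (mapFlat f fun j => (⟨n, fun i => x i j⟩ : Prof C)).trans ((interchange x).map f).symm
      = (interchange fun i j => f (x i j)).symm.trans
        (mapFlat f fun i => (⟨p, x i⟩ : Prof C)) := by
  refine Iso.ext_fun fun k => ?_
  have h := congrArg (fun σ => σ.toEquiv ((interchange fun i j => f (x i j)).symm.toEquiv k))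
    (mapFlat_interchange f x)
  simp only [Iso.trans_toEquiv, Equiv.trans_apply, Iso.symm_toEquiv,
    Equiv.apply_symm_apply] at h ⊢
  rw [Equiv.symm_apply_eq]
  exact h.symm

theorem interchange_symm {n p : ℕ} (x : Fin n → Fin p → C) :
    (interchange fun j i => x i j).symm = interchange x := by
  refine flat_ext (P := fun i => (⟨p, x i⟩ : Prof C)) fun i j => ?_
  rw [interchange_idx x i j, Iso.symm_toEquiv, Equiv.symm_apply_eq]
  exact (interchange_idx (fun j i => x i j) j i).symm

theorem interchange_trans {n p : ℕ} (x : Fin n → Fin p → C) :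
    (interchange fun j i => x i j).trans (interchange x) = Iso.refl _ := by
  rw [← interchange_symm x]
  exact Iso.self_trans_symm _

end Prof

/-- The data of a prop: colours, operations, identities, vertical composition `f ∘_v g`,
horizontal composition `f ∘_h g`, and the symmetric group actions `σ^*` (`pull`) and `τ_*`
(`push`). The identities are recorded for every list of colours; by the law `id_append` below
the identity of `⟨c_1, …, c_n⟩` is `id_{c_1} ∘_h ⋯ ∘_h id_{c_n}`. -/
structure PropData : Type (u + 1) where
  Col : Type u
  Hom : Prof Col → Prof Col → Type u
  id : ∀ a, Hom a a
  vcomp : ∀ {a b c}, Hom b c → Hom a b → Hom a c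
  hcomp : ∀ {a b a' b'}, Hom a b → Hom a' b' → Hom (a.append a') (b.append b')
  pull : ∀ {a a' b}, Prof.Iso a' a → Hom a b → Hom a' b
  push : ∀ {a b b'}, Prof.Iso b b' → Hom a b → Hom a b'

namespace PropData

variable (D : PropData.{u})

/-- Transport of an operation along bijections of its inputs and its outputs. -/
def act {a a' b b' : Prof D.Col} (σ : Prof.Iso a a') (τ : Prof.Iso b b') (f : D.Hom a b) :
    D.Hom a' b' :=
  D.push τ (D.pull σ.symm f)

/-- The horizontal composition `⟨f_i⟩ = f_1 ∘_h ⋯ ∘_h f_n`. -/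
def hprod : {n : ℕ} → {P Q : Fin n → Prof D.Col} → (∀ i, D.Hom (P i) (Q i)) →
    D.Hom (Prof.flat P) (Prof.flat Q)
  | 0, _, _, _ => D.id Prof.nil
  | _ + 1, _, _, f => D.hcomp (f 0) (hprod fun i => f i.succ)

section Octagon

variable {n m p q : ℕ} {A : Fin n → Fin p → D.Col} {A' : Fin n → Fin q → D.Col}
  {B : Fin m → Fin p → D.Col} {B' : Fin m → Fin q → D.Col}
  (u : ∀ i, D.Hom ⟨p, A i⟩ ⟨q, A' i⟩) (v : ∀ k, D.Hom ⟨p, B k⟩ ⟨q, B' k⟩)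
  (f : ∀ j, D.Hom ⟨n, fun i => A i j⟩ ⟨m, fun k => B k j⟩)
  (g : ∀ l, D.Hom ⟨n, fun i => A' i l⟩ ⟨m, fun k => B' k l⟩)

/-- The composite `⟨⟨A_{ij}⟩_j⟩_i → ⟨⟨A'_{il}⟩_l⟩_i ≅ ⟨⟨A'_{il}⟩_i⟩_l → ⟨⟨B'_{kl}⟩_k⟩_l ≅
⟨⟨B'_{kl}⟩_l⟩_k` of `⟨u_i⟩` and `⟨g_l⟩`. -/
def octagonTop : D.Hom (Prof.flat fun i => ⟨p, A i⟩) (Prof.flat fun k => ⟨q, B' k⟩) :=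
  D.vcomp (D.push (Prof.interchange fun l k => B' k l) (D.hprod g))
    (D.push (Prof.interchange A') (D.hprod u))

/-- The composite `⟨⟨A_{ij}⟩_j⟩_i ≅ ⟨⟨A_{ij}⟩_i⟩_j → ⟨⟨B_{kj}⟩_k⟩_j ≅ ⟨⟨B_{kj}⟩_j⟩_k →
⟨⟨B'_{kl}⟩_l⟩_k` of `⟨f_j⟩` and `⟨v_k⟩`. -/
def octagonBottom : D.Hom (Prof.flat fun i => ⟨p, A i⟩) (Prof.flat fun k => ⟨q, B' k⟩) :=
  D.vcomp (D.pull (Prof.interchange fun j k => B k j) (D.hprod v))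
    (D.pull (Prof.interchange A) (D.hprod f))

/-- Commutativity of the octagon with sides `⟨u_i⟩`, `⟨v_k⟩`, `⟨f_j⟩`, `⟨g_l⟩`. -/
def Octagon : Prop := D.octagonTop u g = D.octagonBottom v f

end Octagon

end PropData

/-- A (small, coloured) prop. -/
structure ColoredProp : Type (u + 1) extends PropData.{u} where
  vcomp_assoc : ∀ {a b c d} (f : Hom c d) (g : Hom b c) (h : Hom a b),
    vcomp (vcomp f g) h = vcomp f (vcomp g h)
  id_vcomp : ∀ {a b} (f : Hom a b), vcomp (id b) f = f
  vcomp_id : ∀ {a b} (f : Hom a b), vcomp f (id a) = f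
  id_append : ∀ a b, id (a.append b) = hcomp (id a) (id b)
  hcomp_assoc : ∀ {a b a' b' a'' b''} (f : Hom a b) (g : Hom a' b') (h : Hom a'' b''),
    toPropData.act (.assoc a a' a'') (.assoc b b' b'') (hcomp (hcomp f g) h)
      = hcomp f (hcomp g h)
  nil_hcomp : ∀ {a b} (f : Hom a b),
    toPropData.act (.nilAppend a) (.nilAppend b) (hcomp (id Prof.nil) f) = f
  hcomp_nil : ∀ {a b} (f : Hom a b),
    toPropData.act (.appendNil a) (.appendNil b) (hcomp f (id Prof.nil)) = f
  hcomp_vcomp : ∀ {a b c a' b' c'} (f : Hom b c) (g : Hom a b) (f' : Hom b' c')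
    (g' : Hom a' b'), hcomp (vcomp f g) (vcomp f' g') = vcomp (hcomp f f') (hcomp g g')
  vcomp_push : ∀ {a b b' c} (f : Hom b' c) (σ : Prof.Iso b b') (g : Hom a b),
    vcomp f (push σ g) = vcomp (pull σ f) g
  pull_vcomp : ∀ {a a' b c} (σ : Prof.Iso a' a) (f : Hom b c) (g : Hom a b),
    pull σ (vcomp f g) = vcomp f (pull σ g)
  push_vcomp : ∀ {a b c c'} (τ : Prof.Iso c c') (f : Hom b c) (g : Hom a b),
    push τ (vcomp f g) = vcomp (push τ f) g
  hcomp_pull : ∀ {a b c a' b' c'} (σ : Prof.Iso a b) (σ' : Prof.Iso a' b') (f : Hom b c)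
    (g : Hom b' c'), hcomp (pull σ f) (pull σ' g) = pull (σ.append σ') (hcomp f g)
  hcomp_push : ∀ {a b c a' b' c'} (τ : Prof.Iso b c) (τ' : Prof.Iso b' c') (f : Hom a b)
    (g : Hom a' b'), hcomp (push τ f) (push τ' g) = push (τ.append τ') (hcomp f g)
  hcomp_swap : ∀ {a b a' b'} (f : Hom a b) (g : Hom a' b'),
    pull (.swap a' a) (push (.swap b b') (hcomp f g)) = hcomp g f
  pull_push : ∀ {a a' b b'} (σ : Prof.Iso a' a) (τ : Prof.Iso b b') (f : Hom a b),
    pull σ (push τ f) = push τ (pull σ f)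
  pull_pull : ∀ {a a' a'' b} (σ' : Prof.Iso a'' a') (σ : Prof.Iso a' a) (f : Hom a b),
    pull σ' (pull σ f) = pull (σ'.trans σ) f
  push_push : ∀ {a b b' b''} (τ' : Prof.Iso b' b'') (τ : Prof.Iso b b') (f : Hom a b),
    push τ' (push τ f) = push (τ.trans τ') f
  pull_refl : ∀ {a b} (f : Hom a b), pull (.refl a) f = f
  push_refl : ∀ {a b} (f : Hom a b), push (.refl b) f = f

/-- A function on colours together with functions on operations is a homomorphism if it
commutes with identities, compositions and symmetric group actions. -/
structure IsPropHom (D E : PropData.{u}) (col : D.Col → E.Col)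
    (map : ∀ {a b}, D.Hom a b → E.Hom (a.map col) (b.map col)) : Prop where
  map_id : ∀ a, map (D.id a) = E.id (a.map col)
  map_vcomp : ∀ {a b c} (f : D.Hom b c) (g : D.Hom a b),
    map (D.vcomp f g) = E.vcomp (map f) (map g)
  map_hcomp : ∀ {a b a' b'} (f : D.Hom a b) (g : D.Hom a' b'),
    map (D.hcomp f g)
      = E.act (.mapAppend col a a') (.mapAppend col b b') (E.hcomp (map f) (map g))
  map_pull : ∀ {a a' b} (σ : Prof.Iso a' a) (f : D.Hom a b),
    map (D.pull σ f) = E.pull (σ.map col) (map f)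
  map_push : ∀ {a b b'} (τ : Prof.Iso b b') (f : D.Hom a b),
    map (D.push τ f) = E.push (τ.map col) (map f)

namespace IsPropHom

variable {D E : PropData.{u}} {col : D.Col → E.Col}
  {map : ∀ {a b}, D.Hom a b → E.Hom (a.map col) (b.map col)}

theorem map_act (h : IsPropHom D E col map) {a a' b b'} (σ : Prof.Iso a a')
    (τ : Prof.Iso b b') (f : D.Hom a b) :
    map (D.act σ τ f) = E.act (σ.map col) (τ.map col) (map f) := by
  unfold PropData.act
  rw [h.map_push, h.map_pull]; rfl

end IsPropHom

namespace ColoredProp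

section Lemmas

variable (T : ColoredProp.{u}) {a a' a'' b b' b'' c c' d d' : Prof T.Col}

theorem act_act (σ : Prof.Iso a a') (σ' : Prof.Iso a' a'') (τ : Prof.Iso b b')
    (τ' : Prof.Iso b' b'') (f : T.Hom a b) :
    T.act σ' τ' (T.act σ τ f) = T.act (σ.trans σ') (τ.trans τ') f := by
  unfold PropData.act
  rw [T.pull_push, T.push_push, T.pull_pull]; rfl

theorem act_refl (f : T.Hom a b) : T.act (.refl a) (.refl b) f = f := by
  unfold PropData.act
  rw [T.push_refl]; exact T.pull_refl f

theorem push_eq (τ : Prof.Iso b b') (f : T.Hom a b) : T.push τ f = T.act (.refl a) τ f := by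
  unfold PropData.act
  rw [show (Prof.Iso.refl a).symm = .refl a from rfl, T.pull_refl]

theorem pull_eq (σ : Prof.Iso a' a) (f : T.Hom a b) :
    T.pull σ f = T.act σ.symm (.refl b) f := by
  unfold PropData.act
  rw [T.push_refl]; rfl

theorem hcomp_act (σ : Prof.Iso a a') (τ : Prof.Iso b b') (σ' : Prof.Iso c c')
    (τ' : Prof.Iso d d') (f : T.Hom a b) (g : T.Hom c d) :
    T.hcomp (T.act σ τ f) (T.act σ' τ' g)
      = T.act (σ.append σ') (τ.append τ') (T.hcomp f g) := by
  unfold PropData.act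
  rw [T.hcomp_push, T.hcomp_pull]; rfl

theorem vcomp_act (σ : Prof.Iso a a') (τ : Prof.Iso b b') (ρ : Prof.Iso c c')
    (f : T.Hom b c) (g : T.Hom a b) :
    T.vcomp (T.act τ ρ f) (T.act σ τ g) = T.act σ ρ (T.vcomp f g) := by
  unfold PropData.act
  rw [T.vcomp_push, T.pull_push, T.pull_pull,
    show τ.trans τ.symm = .refl b from Prof.Iso.ext_fun fun i => by simp, T.pull_refl,
    ← T.push_vcomp, ← T.pull_vcomp]

theorem act_id (σ : Prof.Iso a a') : T.act σ σ (T.id a) = T.id a' := by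
  have h : T.push σ (T.id a) = T.pull σ (T.id a') := by
    rw [← T.id_vcomp (T.push σ (T.id a)), T.vcomp_push, T.vcomp_id]
  unfold PropData.act
  rw [← T.pull_push, h, T.pull_pull,
    show σ.symm.trans σ = .refl a' from Prof.Iso.ext_fun fun i => by simp, T.pull_refl]

theorem act_congr {σ σ' : Prof.Iso a a'} {τ τ' : Prof.Iso b b'} {f f' : T.Hom a b}
    (hσ : σ = σ') (hτ : τ = τ') (hf : f = f') : T.act σ τ f = T.act σ' τ' f' := by
  subst hσ hτ hf; rfl

theorem act_symm {σ : Prof.Iso a a'} {τ : Prof.Iso b b'} {f : T.Hom a b} {g : T.Hom a' b'}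
    (h : T.act σ τ f = g) : f = T.act σ.symm τ.symm g := by
  rw [← h, act_act, show σ.trans σ.symm = .refl a from Prof.Iso.ext_fun fun i => by simp,
    show τ.trans τ.symm = .refl b from Prof.Iso.ext_fun fun i => by simp, act_refl]

theorem act_injective {σ : Prof.Iso a a'} {τ : Prof.Iso b b'} {f f' : T.Hom a b}
    (h : T.act σ τ f = T.act σ τ f') : f = f' := by
  rw [T.act_symm h, ← T.act_symm rfl]

theorem hcomp_swap' (f : T.Hom a b) (g : T.Hom a' b') :
    T.act (.swap a a') (.swap b b') (T.hcomp f g) = T.hcomp g f := by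
  rw [← T.hcomp_swap f g]
  unfold PropData.act
  rw [T.pull_push]
  rfl

theorem hcomp_left_comm (f : T.Hom a a') (g : T.Hom b b') (h : T.Hom c c') :
    T.act (.leftComm a b c) (.leftComm a' b' c') (T.hcomp g (T.hcomp f h))
      = T.hcomp f (T.hcomp g h) := by
  unfold Prof.Iso.leftComm
  rw [← act_act, ← act_act, ← T.act_symm (T.hcomp_assoc g f h), ← T.hcomp_assoc,
    ← T.hcomp_swap' g f]
  conv_rhs => rw [← T.act_refl h, hcomp_act]

theorem hcomp_middle (f : T.Hom a a') (g : T.Hom b b') (h : T.Hom c c') (k : T.Hom d d') :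
    T.act (.middle a b c d) (.middle a' b' c' d') (T.hcomp (T.hcomp f g) (T.hcomp h k))
      = T.hcomp (T.hcomp f h) (T.hcomp g k) := by
  unfold Prof.Iso.middle
  rw [← act_act, ← act_act, T.hcomp_assoc, T.act_symm (T.hcomp_assoc f h (T.hcomp g k)),
    ← T.hcomp_left_comm h g k]
  conv_rhs => rw [← T.act_refl f, hcomp_act]

variable {n n' : ℕ}

theorem hprod_vcomp {P Q U : Fin n → Prof T.Col} (f : ∀ i, T.Hom (Q i) (U i))
    (g : ∀ i, T.Hom (P i) (Q i)) :
    T.hprod (fun i => T.vcomp (f i) (g i)) = T.vcomp (T.hprod f) (T.hprod g) := by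
  induction n with
  | zero => exact (T.id_vcomp _).symm
  | succ n ih =>
    simp only [PropData.hprod]
    rw [ih]; exact T.hcomp_vcomp _ _ _ _

theorem hprod_id (P : Fin n → Prof T.Col) :
    T.hprod (fun i => T.id (P i)) = T.id (Prof.flat P) := by
  induction n with
  | zero => rfl
  | succ n ih =>
    simp only [PropData.hprod]
    rw [ih]; exact (T.id_append _ _).symm

theorem hprod_act {P P' Q Q' : Fin n → Prof T.Col} (σ : ∀ i, Prof.Iso (P i) (P' i))
    (τ : ∀ i, Prof.Iso (Q i) (Q' i)) (f : ∀ i, T.Hom (P i) (Q i)) :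
    T.hprod (fun i => T.act (σ i) (τ i) (f i))
      = T.act (Prof.flatCongr σ) (Prof.flatCongr τ) (T.hprod f) := by
  induction n with
  | zero =>
    refine (T.act_refl _).symm.trans (T.act_congr ?_ ?_ rfl) <;>
      exact Prof.Iso.ext_fun fun i => i.elim0
  | succ n ih =>
    have key : ∀ {P P' : Fin (n + 1) → Prof T.Col} (σ : ∀ i, Prof.Iso (P i) (P' i)),
        (σ 0).append (Prof.flatCongr fun i => σ i.succ) = Prof.flatCongr σ := fun {P P'} σ => by
      refine Prof.flat_ext (P := P) fun i => Fin.cases (fun j => ?_) (fun i j => ?_) i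
      · exact (Prof.Iso.append_inl _ _ _).trans (Prof.flatCongr_idx σ 0 j).symm
      · refine (Prof.Iso.append_inr _ _ _).trans (Eq.trans ?_ (Prof.flatCongr_idx σ i.succ j).symm)
        exact congrArg _ (Prof.flatCongr_idx (fun i => σ i.succ) i j)
    simp only [PropData.hprod]
    rw [ih, hcomp_act]
    exact T.act_congr (key σ) (key τ) rfl

theorem hprod_hcomp {P P' Q Q' : Fin n → Prof T.Col} (f : ∀ i, T.Hom (P i) (Q i))
    (g : ∀ i, T.Hom (P' i) (Q' i)) :
    T.hprod (fun i => T.hcomp (f i) (g i))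
      = T.act (Prof.flatAppend P P') (Prof.flatAppend Q Q')
          (T.hcomp (T.hprod f) (T.hprod g)) := by
  induction n with
  | zero =>
    refine Eq.trans ?_ (congrArg _ (T.act_symm (T.nil_hcomp (T.id Prof.nil))).symm)
    refine Eq.trans ?_ (T.act_act _ _ _ _ _).symm
    refine (T.act_refl _).symm.trans (T.act_congr ?_ ?_ rfl) <;>
      exact Prof.Iso.ext_fun fun i => i.elim0
  | succ n ih =>
    simp only [PropData.hprod]
    rw [ih, ← T.act_refl (T.hcomp (f 0) (g 0)), hcomp_act, ← T.hcomp_middle, act_act]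
    exact T.act_congr (Prof.flatAppend_succ P P') (Prof.flatAppend_succ Q Q') rfl

/-- The last operation of a family split off. -/
theorem hprod_snoc {P Q : Fin (n + 1) → Prof T.Col} (f : ∀ i, T.Hom (P i) (Q i)) :
    T.hprod f = T.act (Prof.flatSnoc P) (Prof.flatSnoc Q)
      (T.hcomp (T.hprod fun i => f i.castSucc) (f (Fin.last n))) := by
  induction n with
  | zero =>
    refine (T.act_symm (T.hcomp_nil (f 0))).trans ?_
    refine Eq.trans ?_ (congrArg _ (T.act_symm (T.nil_hcomp (f 0))).symm)
    refine Eq.trans ?_ (T.act_act _ _ _ _ _).symm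
    exact T.act_congr (Prof.flatSnoc_zero P) (Prof.flatSnoc_zero Q) rfl
  | succ n ih =>
    refine (congrArg (T.hcomp (f 0)) (ih fun i => f i.succ)).trans ?_
    refine (congrArg (fun x => T.hcomp x _) (T.act_refl (f 0)).symm).trans ?_
    rw [hcomp_act, ← T.hcomp_assoc, act_act]
    exact T.act_congr (Prof.flatSnoc_succ P) (Prof.flatSnoc_succ Q) rfl

theorem hprod_add {P Q : Fin (n + n') → Prof T.Col} (f : ∀ i, T.Hom (P i) (Q i)) :
    T.hprod f = T.act (Prof.flatAdd P) (Prof.flatAdd Q)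
      (T.hcomp (T.hprod fun i => f (Fin.castAdd n' i)) (T.hprod fun i => f (Fin.natAdd n i))) := by
  induction n' with
  | zero =>
    refine Eq.trans ?_ (congrArg _ (T.act_symm (T.hcomp_nil (T.hprod f))).symm)
    refine Eq.trans ?_ (T.act_act _ _ _ _ _).symm
    exact (T.act_refl _).symm.trans (T.act_congr (Prof.flatAdd_zero P) (Prof.flatAdd_zero Q) rfl)
  | succ n' ih =>
    refine (T.hprod_snoc (n := n + n') f).trans ?_
    rw [ih fun i => f i.castSucc, T.hprod_snoc fun i => f (Fin.natAdd n i)]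
    refine (congrArg (fun x => T.act _ _ (T.hcomp _ x)) (T.act_refl _).symm).trans ?_
    rw [hcomp_act, act_act]
    conv_rhs => rw [← T.act_refl (T.hprod fun i => f (Fin.castAdd (n' + 1) i)), hcomp_act,
      ← T.hcomp_assoc, act_act, act_act]
    exact T.act_congr (Prof.flatAdd_succ P) (Prof.flatAdd_succ Q) rfl

/-- Block permutations of a horizontal composition. -/
theorem hprod_perm (τ : Equiv.Perm (Fin n)) {P Q : Fin n → Prof T.Col}
    (f : ∀ i, T.Hom (P i) (Q i)) :
    T.hprod f = T.act (Prof.flatPerm τ P) (Prof.flatPerm τ Q) (T.hprod fun i => f (τ i)) := by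
  have one : ∀ {n} {P Q : Fin n → Prof T.Col} (f : ∀ i, T.Hom (P i) (Q i)),
      T.hprod f = T.act (Prof.flatPerm 1 P) (Prof.flatPerm 1 Q) (T.hprod f) := fun {n P Q} f => by
    exact (T.act_refl _).symm.trans
      (T.act_congr (Prof.flatPerm_one P) (Prof.flatPerm_one Q) rfl)
  have mul : ∀ {n} (σ τ : Equiv.Perm (Fin n)),
      (∀ {P Q : Fin n → Prof T.Col} (f : ∀ i, T.Hom (P i) (Q i)),
        T.hprod f = T.act (Prof.flatPerm σ P) (Prof.flatPerm σ Q) (T.hprod fun i => f (σ i))) →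
      (∀ {P Q : Fin n → Prof T.Col} (f : ∀ i, T.Hom (P i) (Q i)),
        T.hprod f = T.act (Prof.flatPerm τ P) (Prof.flatPerm τ Q) (T.hprod fun i => f (τ i))) →
      (∀ {P Q : Fin n → Prof T.Col} (f : ∀ i, T.Hom (P i) (Q i)),
        T.hprod f = T.act (Prof.flatPerm (σ * τ) P) (Prof.flatPerm (σ * τ) Q)
          (T.hprod fun i => f ((σ * τ) i))) := fun {n} σ τ hσ hτ {P Q} f => by
    rw [hσ f, hτ fun i => f (σ i), act_act]
    exact T.act_congr (Prof.flatPerm_mul σ τ P) (Prof.flatPerm_mul σ τ Q) rfl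
  have adj : ∀ {n} (i : Fin n) {P Q : Fin (n + 1) → Prof T.Col} (f : ∀ i, T.Hom (P i) (Q i)),
      T.hprod f = T.act (Prof.flatPerm (Equiv.swap i.castSucc i.succ) P)
        (Prof.flatPerm (Equiv.swap i.castSucc i.succ) Q)
        (T.hprod fun k => f (Equiv.swap i.castSucc i.succ k)) := by
    intro n
    induction n with
    | zero => exact fun i => i.elim0
    | succ n ih =>
      refine Fin.cases ?_ fun i => ?_
      · rw [Prof.swap_zero_one]
        intro P Q f
        refine (T.hcomp_left_comm (f 0) (f 1) (T.hprod fun i => f i.succ.succ)).symm.trans ?_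
        exact T.act_congr (Prof.flatPerm_swap P) (Prof.flatPerm_swap Q) rfl
      · rw [Prof.swap_succ]
        intro P Q f
        refine (congrArg (T.hcomp (f 0)) (ih i fun i => f i.succ)).trans ?_
        refine (congrArg (fun x => T.hcomp x _) (T.act_refl (f 0)).symm).trans ?_
        rw [hcomp_act]
        exact T.act_congr (Prof.flatPerm_cons _ P) (Prof.flatPerm_cons _ Q) rfl
  cases n with
  | zero => exact (Subsingleton.elim 1 τ) ▸ one f
  | succ n =>
    revert P Q
    have hτ : τ ∈ Submonoid.closure (Set.range fun i : Fin n => Equiv.swap i.castSucc i.succ) := by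
      rw [Equiv.Perm.mclosure_swap_castSucc_succ]; trivial
    induction hτ using Submonoid.closure_induction with
    | mem τ h => obtain ⟨i, rfl⟩ := h; exact @adj _ i
    | one => exact @one _
    | mul σ τ _ _ hσ hτ => exact @mul _ σ τ hσ hτ

theorem hprod_pos {X : Type u} (x y : Prof X) {P Q : Fin (x.append y).len → Prof T.Col}
    (f : ∀ i, T.Hom (P i) (Q i)) :
    T.hprod f = T.act (Prof.flatPos x y P) (Prof.flatPos x y Q)
      (T.hcomp (T.hprod fun i => f (x.inl y i)) (T.hprod fun i => f (x.inr y i))) :=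
  T.hprod_add (n := x.len) (n' := y.len) f

end Lemmas

end ColoredProp

namespace IsPropHom

variable {D : PropData.{u}} {T : ColoredProp.{u}} {col : D.Col → T.Col}
  {map : ∀ {a b}, D.Hom a b → T.Hom (a.map col) (b.map col)}

theorem map_hprod (h : IsPropHom D T.toPropData col map) {n : ℕ} {P Q : Fin n → Prof D.Col}
    (f : ∀ i, D.Hom (P i) (Q i)) :
    map (D.hprod f) = T.act (Prof.mapFlat col P) (Prof.mapFlat col Q)
      (T.hprod fun i => map (f i)) := by
  induction n with
  | zero =>
    refine (h.map_id _).trans ?_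
    have e : Prof.Iso (Prof.nil : Prof T.Col) ((Prof.nil : Prof D.Col).map col) :=
      Prof.mapFlat col P
    refine (T.act_id e).symm.trans (T.act_congr ?_ ?_ rfl) <;>
      exact Prof.Iso.ext_fun fun i => i.elim0
  | succ n ih =>
    refine (h.map_hcomp _ _).trans ?_
    rw [ih, ← T.act_refl (map (f 0)), T.hcomp_act, T.act_act]
    exact T.act_congr (Prof.mapFlat_succ col P) (Prof.mapFlat_succ col Q) rfl

end IsPropHom

namespace ColoredProp

section Octagon

variable (T : ColoredProp.{u}) {n m p q : ℕ} {A : Fin n → Fin p → T.Col}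
  {A' : Fin n → Fin q → T.Col} {B : Fin m → Fin p → T.Col} {B' : Fin m → Fin q → T.Col}
  (u : ∀ i, T.Hom ⟨p, A i⟩ ⟨q, A' i⟩) (v : ∀ k, T.Hom ⟨p, B k⟩ ⟨q, B' k⟩)
  (f : ∀ j, T.Hom ⟨n, fun i => A i j⟩ ⟨m, fun k => B k j⟩)
  (g : ∀ l, T.Hom ⟨n, fun i => A' i l⟩ ⟨m, fun k => B' k l⟩)

/-- The octagon as a commutative square. -/
theorem octagon_iff : T.Octagon u v f g ↔
    T.vcomp (T.hprod g) (T.act (Prof.interchange A) (Prof.interchange A') (T.hprod u))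
      = T.vcomp (T.act (Prof.interchange B) (Prof.interchange B') (T.hprod v)) (T.hprod f) := by
  have h1 : T.act (Prof.interchange A) (Prof.interchange B') (T.octagonTop u g)
      = T.vcomp (T.hprod g) (T.act (Prof.interchange A) (Prof.interchange A') (T.hprod u)) := by
    unfold PropData.octagonTop
    rw [T.push_eq, T.push_eq, ← T.vcomp_act _ (.refl _) _, T.act_act, T.act_act]
    refine congrArg₂ T.vcomp ?_ ?_
    · exact (T.act_congr rfl (Prof.interchange_trans B') rfl).trans (T.act_refl _)
    · rfl
  have h2 : T.act (Prof.interchange A) (Prof.interchange B') (T.octagonBottom v f)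
      = T.vcomp (T.act (Prof.interchange B) (Prof.interchange B') (T.hprod v)) (T.hprod f) := by
    unfold PropData.octagonBottom
    rw [T.pull_eq, T.pull_eq, ← T.vcomp_act _ (.refl _) _, T.act_act, T.act_act]
    refine congrArg₂ T.vcomp ?_ ?_
    · exact T.act_congr (Prof.interchange_symm B) rfl rfl
    · refine (T.act_congr ?_ rfl rfl).trans (T.act_refl _)
      exact Prof.Iso.symm_trans_self _
  rw [← h1, ← h2]
  exact ⟨fun h => congrArg _ h, fun h => T.act_injective h⟩

section Map

variable {T} {D : PropData.{u}} {A : Fin n → Fin p → D.Col}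
  {A' : Fin n → Fin q → D.Col} {B : Fin m → Fin p → D.Col} {B' : Fin m → Fin q → D.Col}
  {u : ∀ i, D.Hom ⟨p, A i⟩ ⟨q, A' i⟩} {v : ∀ k, D.Hom ⟨p, B k⟩ ⟨q, B' k⟩}
  {f : ∀ j, D.Hom ⟨n, fun i => A i j⟩ ⟨m, fun k => B k j⟩}
  {g : ∀ l, D.Hom ⟨n, fun i => A' i l⟩ ⟨m, fun k => B' k l⟩}
  {col : D.Col → T.Col} {map : ∀ {a b}, D.Hom a b → T.Hom (a.map col) (b.map col)}

theorem map_octagonTop (h : IsPropHom D T.toPropData col map) :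
    map (D.octagonTop u g) = T.act (Prof.mapFlat col _) (Prof.mapFlat col _)
      (T.octagonTop (A := fun i j => col (A i j)) (A' := fun i j => col (A' i j))
        (B' := fun i j => col (B' i j)) (fun i => map (u i)) (fun i => map (g i))) := by
  unfold PropData.octagonTop
  rw [h.map_vcomp, h.map_push, h.map_push, h.map_hprod, h.map_hprod, T.push_eq, T.push_eq,
    T.act_act, T.act_act, T.push_eq, T.push_eq]
  refine Eq.trans ?_ (T.vcomp_act (Prof.mapFlat col fun i => ⟨p, A i⟩)
    (Prof.mapFlat col fun l => ⟨n, fun i => A' i l⟩) (Prof.mapFlat col fun k => ⟨q, B' k⟩) _ _)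
  refine congrArg₂ T.vcomp ?_ ?_
  · refine Eq.trans ?_ (T.act_act _ _ _ _ _).symm
    exact T.act_congr rfl (Prof.mapFlat_interchange col fun l k => B' k l) rfl
  · refine Eq.trans ?_ (T.act_act _ _ _ _ _).symm
    exact T.act_congr rfl (Prof.mapFlat_interchange col A') rfl

theorem map_octagonBottom (h : IsPropHom D T.toPropData col map) :
    map (D.octagonBottom v f) = T.act (Prof.mapFlat col _) (Prof.mapFlat col _)
      (T.octagonBottom (A := fun i j => col (A i j)) (B := fun i j => col (B i j))
        (B' := fun i j => col (B' i j)) (fun i => map (v i)) (fun i => map (f i))) := by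
  unfold PropData.octagonBottom
  rw [h.map_vcomp, h.map_pull, h.map_pull, h.map_hprod, h.map_hprod, T.pull_eq, T.pull_eq,
    T.act_act, T.act_act, T.pull_eq, T.pull_eq]
  refine Eq.trans ?_ (T.vcomp_act (Prof.mapFlat col fun i => ⟨p, A i⟩)
    (Prof.mapFlat col fun j => ⟨m, fun k => B k j⟩) (Prof.mapFlat col fun k => ⟨q, B' k⟩) _ _)
  refine congrArg₂ T.vcomp ?_ ?_
  · refine Eq.trans ?_ (T.act_act _ _ _ _ _).symm
    exact T.act_congr (Prof.mapFlat_interchange_symm col fun j k => B k j) rfl rfl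
  · refine Eq.trans ?_ (T.act_act _ _ _ _ _).symm
    exact T.act_congr (Prof.mapFlat_interchange_symm col A) rfl rfl

theorem map_octagon_of (h : IsPropHom D T.toPropData col map)
    (H : T.Octagon (A := fun i j => col (A i j)) (A' := fun i j => col (A' i j))
      (B := fun i j => col (B i j)) (B' := fun i j => col (B' i j))
      (fun i => map (u i)) (fun i => map (v i)) (fun i => map (f i)) (fun i => map (g i))) :
    map (D.octagonTop u g) = map (D.octagonBottom v f) :=
  (map_octagonTop h).trans ((congrArg _ H).trans (map_octagonBottom h).symm)

theorem octagon_map (h : IsPropHom D T.toPropData col map) (H : D.Octagon u v f g) :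
    T.Octagon (A := fun i j => col (A i j)) (A' := fun i j => col (A' i j))
      (B := fun i j => col (B i j)) (B' := fun i j => col (B' i j))
      (fun i => map (u i)) (fun i => map (v i)) (fun i => map (f i)) (fun i => map (g i)) :=
  T.act_injective ((map_octagonTop h).symm.trans ((congrArg map H).trans (map_octagonBottom h)))

end Map

end Octagon

end ColoredProp

namespace ColoredProp

/-- Homomorphisms of props. -/
structure PropHom (R T : ColoredProp.{u}) : Type u where
  col : R.Col → T.Col
  map : ∀ {a b}, R.Hom a b → T.Hom (a.map col) (b.map col)
  isHom : IsPropHom R.toPropData T.toPropData col map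

/-- A `(p, q)` natural transformation `⟨f_1, …, f_p⟩ ⇒ ⟨g_1, …, g_q⟩` of homomorphisms
`R → T`. -/
@[ext] structure NatTrans {R T : ColoredProp.{u}} (fs gs : Prof (PropHom R T)) : Type u where
  app : ∀ a : R.Col, T.Hom (fs.map fun f => f.col a) (gs.map fun g => g.col a)
  natural : ∀ {a b : Prof R.Col} (φ : R.Hom a b),
    T.Octagon (fun i => app (a.get i)) (fun k => app (b.get k))
      (fun j => (fs.get j).map φ) (fun l => (gs.get l).map φ)

namespace NatTrans

variable {R T : ColoredProp.{u}}

/-- `⟨⟨f_j a_i⟩_j⟩_i ≅ ⟨⟨f_j a_i⟩_i⟩_j`. -/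
def ic (fs : Prof (PropHom R T)) (a : Prof R.Col) :
    Prof.Iso (Prof.flat fun i => fs.map fun f => f.col (a.get i))
      (Prof.flat fun j => a.map (fs.get j).col) :=
  Prof.interchange fun i j => (fs.get j).col (a.get i)

theorem ic_idx (fs : Prof (PropHom R T)) (a : Prof R.Col) (i j) :
    (ic fs a).toEquiv (Prof.idx _ ⟨i, j⟩) = Prof.idx _ ⟨j, i⟩ :=
  Prof.interchange_idx (fun i j => (fs.get j).col (a.get i)) i j

/-- The naturality condition as a commutative square. -/
def Square {fs gs : Prof (PropHom R T)}
    (app : ∀ a : R.Col, T.Hom (fs.map fun f => f.col a) (gs.map fun g => g.col a)) : Prop :=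
  ∀ (a b : Prof R.Col) (φ : R.Hom a b),
    T.vcomp (T.hprod fun l => (gs.get l).map φ)
        (T.act (ic fs a) (ic gs a) (T.hprod fun i => app (a.get i)))
      = T.vcomp (T.act (ic fs b) (ic gs b) (T.hprod fun k => app (b.get k)))
        (T.hprod fun j => (fs.get j).map φ)

theorem square {fs gs : Prof (PropHom R T)} (ξ : NatTrans fs gs) : Square ξ.app :=
  fun _ _ φ => (T.octagon_iff _ _ _ _).1 (ξ.natural φ)

theorem Square.natural {fs gs : Prof (PropHom R T)}
    {app : ∀ a : R.Col, T.Hom (fs.map fun f => f.col a) (gs.map fun g => g.col a)}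
    (h : Square app) {a b : Prof R.Col} (φ : R.Hom a b) :
    T.Octagon (fun i => app (a.get i)) (fun k => app (b.get k))
      (fun j => (fs.get j).map φ) (fun l => (gs.get l).map φ) :=
  (T.octagon_iff _ _ _ _).2 (h _ _ φ)

/-- Bijections of lists of homomorphisms act on columns. -/
def colIso {fs gs : Prof (PropHom R T)} (τ : Prof.Iso fs gs) (a : Prof R.Col) :
    Prof.Iso (Prof.flat fun j => a.map (fs.get j).col) (Prof.flat fun j => a.map (gs.get j).col) :=
  Prof.flatIso (show (Σ _ : Fin fs.len, Fin a.len) ≃ (Σ _ : Fin gs.len, Fin a.len) from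
    ⟨fun x => ⟨τ.toEquiv x.1, x.2⟩, fun x => ⟨τ.toEquiv.symm x.1, x.2⟩,
      fun x => by simp, fun x => by simp⟩)
    fun i j => congrArg (fun f : PropHom R T => f.col (a.get j)) (τ.get_eq i)

theorem colIso_idx {fs gs : Prof (PropHom R T)} (τ : Prof.Iso fs gs) (a : Prof R.Col) (j i) :
    (colIso τ a).toEquiv (Prof.idx _ ⟨j, i⟩) = Prof.idx _ ⟨τ.toEquiv j, i⟩ :=
  Prof.flatIso_idx _ _ _ _

theorem col_act_aux {n m : ℕ} (f : Fin n → PropHom R T) (g : Fin m → PropHom R T)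
    (e : Fin n ≃ Fin m) (he : ∀ i, g (e i) = f i) {a b : Prof R.Col} (φ : R.Hom a b) :
    T.hprod (fun j => (g j).map φ)
      = T.act (colIso (fs := ⟨n, f⟩) (gs := ⟨m, g⟩) ⟨e, he⟩ a)
        (colIso (fs := ⟨n, f⟩) (gs := ⟨m, g⟩) ⟨e, he⟩ b) (T.hprod fun j => (f j).map φ) := by
  obtain rfl : n = m := Fin.equiv_iff_eq.1 ⟨e⟩
  obtain rfl : (fun i => g (e i)) = f := funext he
  refine (T.hprod_perm e _).trans (T.act_congr ?_ ?_ rfl)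
  · refine Prof.flat_ext fun j i => ?_
    exact (Prof.flatPerm_idx e (fun j => a.map (g j).col) j i).trans
      (colIso_idx (fs := ⟨n, fun i => g (e i)⟩) (gs := ⟨n, g⟩) ⟨e, he⟩ a j i).symm
  · refine Prof.flat_ext fun j i => ?_
    exact (Prof.flatPerm_idx e (fun j => b.map (g j).col) j i).trans
      (colIso_idx (fs := ⟨n, fun i => g (e i)⟩) (gs := ⟨n, g⟩) ⟨e, he⟩ b j i).symm

theorem col_act {fs gs : Prof (PropHom R T)} (τ : Prof.Iso fs gs) {a b : Prof R.Col}
    (φ : R.Hom a b) :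
    T.hprod (fun j => (gs.get j).map φ)
      = T.act (colIso τ a) (colIso τ b) (T.hprod fun j => (fs.get j).map φ) :=
  col_act_aux fs.get gs.get τ.toEquiv τ.get_eq φ

theorem ic_act {fs gs : Prof (PropHom R T)} (τ : Prof.Iso fs gs) (a : Prof R.Col) :
    (Prof.flatCongr fun i => τ.map fun f => f.col (a.get i)).trans (ic gs a)
      = (ic fs a).trans (colIso τ a) := by
  refine Prof.flat_ext fun i j => ?_
  have h1 := congrArg (ic gs a).toEquiv
    (Prof.flatCongr_idx (fun i => τ.map fun f => f.col (a.get i)) i j)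
  have h2 := congrArg (colIso τ a).toEquiv (ic_idx fs a i j)
  exact h1.trans ((ic_idx gs a i (τ.toEquiv j)).trans ((colIso_idx τ a j i).symm.trans h2.symm))

theorem square_act {fs fs' gs gs' : Prof (PropHom R T)} (σ : Prof.Iso fs fs')
    (τ : Prof.Iso gs gs')
    {app : ∀ a : R.Col, T.Hom (fs.map fun f => f.col a) (gs.map fun g => g.col a)}
    (h : Square app) :
    Square (fs := fs') (gs := gs') fun a =>
      T.act (σ.map fun f => f.col a) (τ.map fun f => f.col a) (app a) := by
  intro a b φ
  have key : ∀ a : Prof R.Col, T.act (ic fs' a) (ic gs' a) (T.hprod fun i =>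
      T.act (σ.map fun f => f.col (a.get i)) (τ.map fun f => f.col (a.get i)) (app (a.get i)))
      = T.act (colIso σ a) (colIso τ a)
        (T.act (ic fs a) (ic gs a) (T.hprod fun i => app (a.get i))) := fun a => by
    rw [T.hprod_act, T.act_act, T.act_act]
    exact T.act_congr (ic_act σ a) (ic_act τ a) rfl
  rw [key, key, col_act σ, col_act τ, T.vcomp_act, T.vcomp_act, h _ _ φ]

theorem square_vcomp {fs gs hs : Prof (PropHom R T)}
    {ξ : ∀ a : R.Col, T.Hom (gs.map fun f => f.col a) (hs.map fun g => g.col a)}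
    {ζ : ∀ a : R.Col, T.Hom (fs.map fun f => f.col a) (gs.map fun g => g.col a)}
    (hξ : Square ξ) (hζ : Square ζ) :
    Square (fs := fs) (gs := hs) fun a => T.vcomp (ξ a) (ζ a) := by
  intro a b φ
  rw [T.hprod_vcomp, T.hprod_vcomp, ← T.vcomp_act (ic fs a) (ic gs a) (ic hs a),
    ← T.vcomp_act (ic fs b) (ic gs b) (ic hs b), ← T.vcomp_assoc, hξ _ _ φ, T.vcomp_assoc, hζ _ _ φ,
    T.vcomp_assoc]

theorem square_id (fs : Prof (PropHom R T)) :
    Square (fs := fs) (gs := fs) fun a => T.id (fs.map fun f => f.col a) := by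
  intro a b φ
  rw [T.hprod_id, T.hprod_id, T.act_id, T.act_id, T.vcomp_id, T.id_vcomp]

/-- Equal homomorphisms have equal values on lists of colours. -/
def colEq {f g : PropHom R T} (h : f = g) (a : Prof R.Col) :
    Prof.Iso (a.map f.col) (a.map g.col) :=
  ⟨Equiv.refl _, fun i => congrArg (fun f : PropHom R T => f.col (a.get i)) h.symm⟩

theorem map_eq {f g : PropHom R T} (h : f = g) {a b : Prof R.Col} (φ : R.Hom a b) :
    T.act (colEq h a) (colEq h b) (f.map φ) = g.map φ := by
  subst h
  exact T.act_refl _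

/-- Columns of a concatenated list of homomorphisms. -/
def colAppend (fs gs : Prof (PropHom R T)) (a : Prof R.Col) :
    Prof.Iso ((Prof.flat fun j => a.map (fs.get j).col).append
        (Prof.flat fun j => a.map (gs.get j).col))
      (Prof.flat fun j => a.map ((fs.append gs).get j).col) :=
  (Prof.Iso.append
    (Prof.flatCongr fun j => colEq (Prof.get_inl fs gs j).symm a)
    (Prof.flatCongr fun j => colEq (Prof.get_inr fs gs j).symm a)).trans
    (Prof.flatPos fs gs fun j => a.map ((fs.append gs).get j).col)

theorem colAppend_inl (fs gs : Prof (PropHom R T)) (a : Prof R.Col) (j i) :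
    (colAppend fs gs a).toEquiv (Prof.inl _ _ (Prof.idx _ ⟨j, i⟩))
      = Prof.idx (fun j => a.map ((fs.append gs).get j).col) ⟨fs.inl gs j, i⟩ := by
  unfold colAppend
  rw [Prof.Iso.trans_toEquiv, Equiv.trans_apply, Prof.Iso.append_inl, Prof.flatCongr_idx]
  exact Prof.flatPos_inl fs gs (fun j => a.map ((fs.append gs).get j).col) j i

theorem colAppend_inr (fs gs : Prof (PropHom R T)) (a : Prof R.Col) (j i) :
    (colAppend fs gs a).toEquiv (Prof.inr _ _ (Prof.idx _ ⟨j, i⟩))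
      = Prof.idx (fun j => a.map ((fs.append gs).get j).col) ⟨fs.inr gs j, i⟩ := by
  unfold colAppend
  rw [Prof.Iso.trans_toEquiv, Equiv.trans_apply, Prof.Iso.append_inr, Prof.flatCongr_idx]
  exact Prof.flatPos_inr fs gs (fun j => a.map ((fs.append gs).get j).col) j i

theorem col_append (fs gs : Prof (PropHom R T)) {a b : Prof R.Col} (φ : R.Hom a b) :
    T.hprod (fun j => ((fs.append gs).get j).map φ)
      = T.act (colAppend fs gs a) (colAppend fs gs b)
        (T.hcomp (T.hprod fun j => (fs.get j).map φ) (T.hprod fun j => (gs.get j).map φ)) := by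
  refine (T.hprod_pos fs gs fun j => ((fs.append gs).get j).map φ).trans ?_
  unfold colAppend
  rw [← T.act_act, ← T.hcomp_act, ← T.hprod_act, ← T.hprod_act]
  refine T.act_congr rfl rfl (congrArg₂ T.hcomp (congrArg T.hprod (funext fun j => ?_))
    (congrArg T.hprod (funext fun j => ?_)))
  · exact (map_eq (Prof.get_inl fs gs j).symm φ).symm
  · exact (map_eq (Prof.get_inr fs gs j).symm φ).symm

theorem ic_append (fs gs : Prof (PropHom R T)) (a : Prof R.Col) :
    ((Prof.flatAppend _ _).trans (Prof.flatCongr fun i =>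
        Prof.Iso.mapAppend (fun f : PropHom R T => f.col (a.get i)) fs gs)).trans
          (ic (fs.append gs) a)
      = ((ic fs a).append (ic gs a)).trans (colAppend fs gs a) := by
  refine Prof.flat_append_ext (fun i j => ?_) (fun i j => ?_)
  · simp only [Prof.Iso.trans_toEquiv, Equiv.trans_apply, Prof.Iso.append_inl,
      Prof.flatAppend_inl, Prof.flatCongr_idx, ic_idx]
    exact (colAppend_inl fs gs a j i).symm
  · simp only [Prof.Iso.trans_toEquiv, Equiv.trans_apply, Prof.Iso.append_inr,
      Prof.flatAppend_inr, Prof.flatCongr_idx, ic_idx]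
    exact (colAppend_inr fs gs a j i).symm

theorem square_hcomp {fs gs fs' gs' : Prof (PropHom R T)}
    {ξ : ∀ a : R.Col, T.Hom (fs.map fun f => f.col a) (gs.map fun g => g.col a)}
    {ζ : ∀ a : R.Col, T.Hom (fs'.map fun f => f.col a) (gs'.map fun g => g.col a)}
    (hξ : Square ξ) (hζ : Square ζ) :
    Square (fs := fs.append fs') (gs := gs.append gs') fun a =>
      T.act (.mapAppend _ fs fs') (.mapAppend _ gs gs') (T.hcomp (ξ a) (ζ a)) := by
  intro a b φ
  have key : ∀ a : Prof R.Col, T.act (ic (fs.append fs') a) (ic (gs.append gs') a)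
      (T.hprod fun i => T.act (.mapAppend (fun f : PropHom R T => f.col (a.get i)) fs fs')
        (.mapAppend (fun f : PropHom R T => f.col (a.get i)) gs gs')
          (T.hcomp (ξ (a.get i)) (ζ (a.get i))))
      = T.act (colAppend fs fs' a) (colAppend gs gs' a)
        (T.hcomp (T.act (ic fs a) (ic gs a) (T.hprod fun i => ξ (a.get i)))
          (T.act (ic fs' a) (ic gs' a) (T.hprod fun i => ζ (a.get i)))) := fun a => by
    rw [T.hprod_act, T.hprod_hcomp, T.hcomp_act, T.act_act, T.act_act, T.act_act]
    exact T.act_congr (ic_append fs fs' a) (ic_append gs gs' a) rfl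
  rw [key, key, col_append, col_append, T.vcomp_act, T.vcomp_act, ← T.hcomp_vcomp,
    ← T.hcomp_vcomp, hξ _ _ φ, hζ _ _ φ]

theorem square_pull {fs fs' gs : Prof (PropHom R T)} (σ : Prof.Iso fs' fs)
    {app : ∀ a : R.Col, T.Hom (fs.map fun f => f.col a) (gs.map fun g => g.col a)}
    (h : Square app) :
    Square (fs := fs') (gs := gs) fun a => T.pull (σ.map fun f => f.col a) (app a) := by
  have := square_act σ.symm (.refl gs) h
  convert this using 2 with a
  exact T.pull_eq _ _

theorem square_push {fs gs gs' : Prof (PropHom R T)} (τ : Prof.Iso gs gs')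
    {app : ∀ a : R.Col, T.Hom (fs.map fun f => f.col a) (gs.map fun g => g.col a)}
    (h : Square app) :
    Square (fs := fs) (gs := gs') fun a => T.push (τ.map fun f => f.col a) (app a) := by
  have := square_act (.refl fs) τ h
  convert this using 2 with a
  exact T.push_eq _ _

end NatTrans

section Components

variable (T : ColoredProp.{u}) {X : Type u} (ev : X → T.Col) {a b a' b' a'' b'' c c' : Prof X}

theorem comp_id_append : T.id ((a.append b).map ev)
    = T.act (.mapAppend ev a b) (.mapAppend ev a b) (T.hcomp (T.id (a.map ev)) (T.id (b.map ev)))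
    := by
  rw [← T.id_append, T.act_id]

theorem comp_hcomp_assoc (f : T.Hom (a.map ev) (b.map ev)) (g : T.Hom (a'.map ev) (b'.map ev))
    (h : T.Hom (a''.map ev) (b''.map ev)) :
    T.act ((Prof.Iso.assoc a a' a'').map ev) ((Prof.Iso.assoc b b' b'').map ev)
      (T.act (.mapAppend ev _ _) (.mapAppend ev _ _)
        (T.hcomp (T.act (.mapAppend ev _ _) (.mapAppend ev _ _) (T.hcomp f g)) h))
      = T.act (.mapAppend ev _ _) (.mapAppend ev _ _)
        (T.hcomp f (T.act (.mapAppend ev _ _) (.mapAppend ev _ _) (T.hcomp g h))) := by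
  conv_lhs => rw [← T.act_refl h, T.hcomp_act, T.act_act, T.act_act]
  conv_rhs => rw [← T.act_refl f, T.hcomp_act, T.act_act, ← T.hcomp_assoc, T.act_act]
  exact T.act_congr (Prof.Iso.map_assoc _ _ _ _) (Prof.Iso.map_assoc _ _ _ _) rfl

theorem comp_nil_hcomp (f : T.Hom (a.map ev) (b.map ev)) :
    T.act ((Prof.Iso.nilAppend a).map ev) ((Prof.Iso.nilAppend b).map ev)
      (T.act (.mapAppend ev _ _) (.mapAppend ev _ _)
        (T.hcomp (T.id ((Prof.nil : Prof X).map ev)) f)) = f := by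
  conv_lhs => rw [← T.act_id (Prof.Iso.mapNil ev), ← T.act_refl f, T.hcomp_act, T.act_act,
    T.act_act]
  conv_rhs => rw [← T.nil_hcomp f]
  exact T.act_congr (Prof.Iso.map_nilAppend _ _) (Prof.Iso.map_nilAppend _ _) rfl

theorem comp_hcomp_nil (f : T.Hom (a.map ev) (b.map ev)) :
    T.act ((Prof.Iso.appendNil a).map ev) ((Prof.Iso.appendNil b).map ev)
      (T.act (.mapAppend ev _ _) (.mapAppend ev _ _)
        (T.hcomp f (T.id ((Prof.nil : Prof X).map ev)))) = f := by
  conv_lhs => rw [← T.act_id (Prof.Iso.mapNil ev), ← T.act_refl f, T.hcomp_act, T.act_act,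
    T.act_act]
  conv_rhs => rw [← T.hcomp_nil f]
  exact T.act_congr (Prof.Iso.map_appendNil _ _) (Prof.Iso.map_appendNil _ _) rfl

theorem comp_hcomp_vcomp (f : T.Hom (b.map ev) (c.map ev)) (g : T.Hom (a.map ev) (b.map ev))
    (f' : T.Hom (b'.map ev) (c'.map ev)) (g' : T.Hom (a'.map ev) (b'.map ev)) :
    T.act (.mapAppend ev a a') (.mapAppend ev c c') (T.hcomp (T.vcomp f g) (T.vcomp f' g'))
      = T.vcomp (T.act (.mapAppend ev b b') (.mapAppend ev c c') (T.hcomp f f'))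
        (T.act (.mapAppend ev a a') (.mapAppend ev b b') (T.hcomp g g')) := by
  rw [T.vcomp_act, T.hcomp_vcomp]

theorem comp_hcomp_pull (σ : Prof.Iso a b) (σ' : Prof.Iso a' b')
    (f : T.Hom (b.map ev) (c.map ev)) (g : T.Hom (b'.map ev) (c'.map ev)) :
    T.act (.mapAppend ev a a') (.mapAppend ev c c')
      (T.hcomp (T.pull (σ.map ev) f) (T.pull (σ'.map ev) g))
      = T.pull ((σ.append σ').map ev)
        (T.act (.mapAppend ev b b') (.mapAppend ev c c') (T.hcomp f g)) := by
  rw [T.pull_eq, T.pull_eq, T.pull_eq, T.hcomp_act, T.act_act, T.act_act]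
  refine T.act_congr ?_ ?_ rfl
  · exact Prof.Iso.map_append σ.symm σ'.symm ev
  · exact Prof.Iso.append_ext (fun i => Prof.Iso.append_inl _ _ _)
      (fun i => Prof.Iso.append_inr _ _ _)

theorem comp_hcomp_push (τ : Prof.Iso b c) (τ' : Prof.Iso b' c')
    (f : T.Hom (a.map ev) (b.map ev)) (g : T.Hom (a'.map ev) (b'.map ev)) :
    T.act (.mapAppend ev a a') (.mapAppend ev c c')
      (T.hcomp (T.push (τ.map ev) f) (T.push (τ'.map ev) g))
      = T.push ((τ.append τ').map ev)
        (T.act (.mapAppend ev a a') (.mapAppend ev b b') (T.hcomp f g)) := by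
  rw [T.push_eq, T.push_eq, T.push_eq, T.hcomp_act, T.act_act, T.act_act]
  refine T.act_congr ?_ ?_ rfl
  · exact Prof.Iso.append_ext (fun i => Prof.Iso.append_inl _ _ _)
      (fun i => Prof.Iso.append_inr _ _ _)
  · exact Prof.Iso.map_append τ τ' ev

theorem comp_hcomp_swap (f : T.Hom (a.map ev) (b.map ev)) (g : T.Hom (a'.map ev) (b'.map ev)) :
    T.pull ((Prof.Iso.swap a' a).map ev) (T.push ((Prof.Iso.swap b b').map ev)
      (T.act (.mapAppend ev a a') (.mapAppend ev b b') (T.hcomp f g)))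
      = T.act (.mapAppend ev a' a) (.mapAppend ev b' b) (T.hcomp g f) := by
  rw [T.pull_eq, T.push_eq, T.act_act, T.act_act, ← T.hcomp_swap' f, T.act_act]
  exact T.act_congr (Prof.Iso.map_swap _ _ _) (Prof.Iso.map_swap _ _ _) rfl

end Components

/-- The internal hom: colours are homomorphisms `R → T`, operations are natural transformations,
and the structure is that of `T` applied componentwise. -/
def ihomData (R T : ColoredProp.{u}) : PropData.{u} where
  Col := PropHom R T
  Hom := NatTrans
  id fs := ⟨fun a => T.id (fs.map fun f => f.col a), (NatTrans.square_id fs).natural⟩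
  vcomp ξ ζ := ⟨fun a => T.vcomp (ξ.app a) (ζ.app a),
    (NatTrans.square_vcomp ξ.square ζ.square).natural⟩
  hcomp {fs gs fs' gs'} ξ ζ := ⟨fun a => T.act (.mapAppend (fun f : PropHom R T => f.col a) fs fs')
      (.mapAppend (fun f : PropHom R T => f.col a) gs gs') (T.hcomp (ξ.app a) (ζ.app a)),
    (NatTrans.square_hcomp ξ.square ζ.square).natural⟩
  pull σ ξ := ⟨fun a => T.pull (σ.map fun f => f.col a) (ξ.app a),
    (NatTrans.square_pull σ ξ.square).natural⟩
  push τ ξ := ⟨fun a => T.push (τ.map fun f => f.col a) (ξ.app a),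
    (NatTrans.square_push τ ξ.square).natural⟩

/-- The internal-hom prop. -/
def ihom (R T : ColoredProp.{u}) : ColoredProp.{u} where
  toPropData := ihomData R T
  vcomp_assoc _ _ _ := NatTrans.ext (funext fun _ => T.vcomp_assoc _ _ _)
  id_vcomp _ := NatTrans.ext (funext fun _ => T.id_vcomp _)
  vcomp_id _ := NatTrans.ext (funext fun _ => T.vcomp_id _)
  id_append _ _ := NatTrans.ext (funext fun _ => comp_id_append T _)
  hcomp_assoc _ _ _ := NatTrans.ext (funext fun _ => comp_hcomp_assoc T _ _ _ _)
  nil_hcomp _ := NatTrans.ext (funext fun _ => comp_nil_hcomp T _ _)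
  hcomp_nil _ := NatTrans.ext (funext fun _ => comp_hcomp_nil T _ _)
  hcomp_vcomp _ _ _ _ := NatTrans.ext (funext fun _ => comp_hcomp_vcomp T _ _ _ _ _)
  vcomp_push _ _ _ := NatTrans.ext (funext fun _ => T.vcomp_push _ _ _)
  pull_vcomp _ _ _ := NatTrans.ext (funext fun _ => T.pull_vcomp _ _ _)
  push_vcomp _ _ _ := NatTrans.ext (funext fun _ => T.push_vcomp _ _ _)
  hcomp_pull _ _ _ _ := NatTrans.ext (funext fun _ => comp_hcomp_pull T _ _ _ _ _)
  hcomp_push _ _ _ _ := NatTrans.ext (funext fun _ => comp_hcomp_push T _ _ _ _ _)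
  hcomp_swap _ _ := NatTrans.ext (funext fun _ => comp_hcomp_swap T _ _ _)
  pull_push _ _ _ := NatTrans.ext (funext fun _ => T.pull_push _ _ _)
  pull_pull _ _ _ := NatTrans.ext (funext fun _ => T.pull_pull _ _ _)
  push_push _ _ _ := NatTrans.ext (funext fun _ => T.push_push _ _ _)
  pull_refl _ := NatTrans.ext (funext fun _ => T.pull_refl _)
  push_refl _ := NatTrans.ext (funext fun _ => T.push_refl _)

namespace PropHom

variable {Q R S T : ColoredProp.{u}}

/-- The identity homomorphism. -/
def id (T : ColoredProp.{u}) : PropHom T T where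
  col := fun c => c
  map f := f
  isHom :=
    { map_id _ := rfl
      map_vcomp _ _ := rfl
      map_hcomp _ _ := (T.act_refl _).symm
      map_pull _ _ := rfl
      map_push _ _ := rfl }

/-- Composition of homomorphisms, in diagrammatic order. -/
def comp (f : PropHom R S) (g : PropHom S T) : PropHom R T where
  col := fun c => g.col (f.col c)
  map φ := g.map (f.map φ)
  isHom :=
    { map_id a := by rw [f.isHom.map_id, g.isHom.map_id]
      map_vcomp _ _ := by rw [f.isHom.map_vcomp, g.isHom.map_vcomp]
      map_hcomp _ _ := by
        rw [f.isHom.map_hcomp, g.isHom.map_act, g.isHom.map_hcomp, T.act_act]; rfl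
      map_pull _ _ := by rw [f.isHom.map_pull, g.isHom.map_pull]; rfl
      map_push _ _ := by rw [f.isHom.map_push, g.isHom.map_push]; rfl }

end PropHom

/-- The category of props. -/
instance : CategoryTheory.Category ColoredProp.{u} where
  Hom := PropHom
  id := PropHom.id
  comp := PropHom.comp

/-- Functoriality of the internal hom: `f ↦ h ∘ f ∘ k` on colours and
`ξ ↦ (h(ξ_{k a}))_a` on operations. -/
def ihomMap {R R' T T' : ColoredProp.{u}} (k : PropHom R' R) (h : PropHom T T') :
    PropHom (ihom R T) (ihom R' T') where
  col := fun f : PropHom R T => (k.comp f).comp h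
  map {fs gs} ξ := (show NatTrans (fs.map _) (gs.map _) from
    { app := fun a => h.map (NatTrans.app ξ (k.col a))
      natural := fun φ => octagon_map h.isHom (NatTrans.natural ξ (k.map φ)) })
  isHom :=
    { map_id _ := NatTrans.ext (funext fun _ => h.isHom.map_id _)
      map_vcomp _ _ := NatTrans.ext (funext fun _ => h.isHom.map_vcomp _ _)
      map_hcomp {fs gs fs' gs'} ξ ζ := NatTrans.ext (funext fun a => by
        refine (h.isHom.map_act _ _ _).trans ?_
        refine (congrArg _ (h.isHom.map_hcomp _ _)).trans ?_
        refine (T'.act_act _ _ _ _ _).trans ?_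
        exact (T'.act_act
          (.mapAppend (fun f : PropHom R' T' => f.col a) (fs.map fun f => (k.comp f).comp h)
            (fs'.map fun f => (k.comp f).comp h))
          ((Prof.Iso.mapAppend (fun f : PropHom R T => (k.comp f).comp h) fs fs').map
            fun f : PropHom R' T' => f.col a)
          (.mapAppend (fun f : PropHom R' T' => f.col a) (gs.map fun f => (k.comp f).comp h)
            (gs'.map fun f => (k.comp f).comp h))
          ((Prof.Iso.mapAppend (fun f : PropHom R T => (k.comp f).comp h) gs gs').map
            fun f : PropHom R' T' => f.col a)
          (T'.hcomp (h.map (NatTrans.app ξ (k.col a))) (h.map (NatTrans.app ζ (k.col a))))).symm)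
      map_pull _ _ := NatTrans.ext (funext fun _ => h.isHom.map_pull _ _)
      map_push _ _ := NatTrans.ext (funext fun _ => h.isHom.map_push _ _) }

/-- A bilinear map `(R, S) → T`. -/
structure Bilin (R S T : ColoredProp.{u}) : Type u where
  col : R.Col → S.Col → T.Col
  left : ∀ {a b : Prof R.Col}, R.Hom a b → ∀ c : S.Col,
    T.Hom (a.map fun x => col x c) (b.map fun x => col x c)
  right : ∀ (a : R.Col) {c d : Prof S.Col}, S.Hom c d → T.Hom (c.map (col a)) (d.map (col a))
  left_isHom : ∀ c, IsPropHom R.toPropData T.toPropData (fun x => col x c) (fun φ => left φ c)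
  right_isHom : ∀ a, IsPropHom S.toPropData T.toPropData (col a) (fun ψ => right a ψ)
  octagon : ∀ {a b : Prof R.Col} (φ : R.Hom a b) {c d : Prof S.Col} (ψ : S.Hom c d),
    T.Octagon (fun j => left φ (c.get j)) (fun l => left φ (d.get l))
      (fun i => right (a.get i) ψ) (fun k => right (b.get k) ψ)

namespace Bilin

variable {R R' S S' T T' : ColoredProp.{u}}

/-- The homomorphism `R → Hom(S, T)`, `a ↦ β(a, -)`, `φ ↦ (β(φ, c))_c`, of a bilinear map. -/
def toHom (β : Bilin R S T) : PropHom R (ihom S T) where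
  col a := (⟨β.col a, β.right a, β.right_isHom a⟩ : PropHom S T)
  map φ := (⟨fun c => β.left φ c, fun ψ => β.octagon φ ψ⟩ : NatTrans _ _)
  isHom :=
    { map_id a := NatTrans.ext (funext fun c => (β.left_isHom c).map_id a)
      map_vcomp f g := NatTrans.ext (funext fun c => (β.left_isHom c).map_vcomp f g)
      map_hcomp {a b a' b'} f g := NatTrans.ext (funext fun c =>
        ((β.left_isHom c).map_hcomp f g).trans (T.act_act
          (.mapAppend (fun h : PropHom S T => h.col c) (a.map fun x => ⟨β.col x, β.right x, β.right_isHom x⟩)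
            (a'.map fun x => ⟨β.col x, β.right x, β.right_isHom x⟩))
          ((Prof.Iso.mapAppend
            (fun x => (⟨β.col x, β.right x, β.right_isHom x⟩ : PropHom S T)) a a').map
            fun h : PropHom S T => h.col c)
          (.mapAppend (fun h : PropHom S T => h.col c) (b.map fun x => ⟨β.col x, β.right x, β.right_isHom x⟩)
            (b'.map fun x => ⟨β.col x, β.right x, β.right_isHom x⟩))
          ((Prof.Iso.mapAppend
            (fun x => (⟨β.col x, β.right x, β.right_isHom x⟩ : PropHom S T)) b b').map
            fun h : PropHom S T => h.col c)
          (T.hcomp (β.left f c) (β.left g c))).symm)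
      map_pull σ f := NatTrans.ext (funext fun c => (β.left_isHom c).map_pull σ f)
      map_push σ f := NatTrans.ext (funext fun c => (β.left_isHom c).map_push σ f) }

/-- A bilinear map followed by a homomorphism. -/
def comp (β : Bilin R S T) (h : PropHom T T') : Bilin R S T' where
  col a c := h.col (β.col a c)
  left φ c := h.map (β.left φ c)
  right a _ _ ψ := h.map (β.right a ψ)
  left_isHom c := (PropHom.comp ⟨_, _, β.left_isHom c⟩ h).isHom
  right_isHom a := (PropHom.comp ⟨_, _, β.right_isHom a⟩ h).isHom
  octagon φ _ _ ψ := octagon_map h.isHom (β.octagon φ ψ)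

/-- A bilinear map preceded by a pair of homomorphisms. -/
def pre (f : PropHom R' R) (g : PropHom S' S) (β : Bilin R S T) : Bilin R' S' T where
  col a c := β.col (f.col a) (g.col c)
  left φ c := β.left (f.map φ) (g.col c)
  right a _ _ ψ := β.right (f.col a) (g.map ψ)
  left_isHom c := (PropHom.comp f ⟨_, _, β.left_isHom (g.col c)⟩).isHom
  right_isHom a := (PropHom.comp g ⟨_, _, β.right_isHom (f.col a)⟩).isHom
  octagon φ _ _ ψ := β.octagon (f.map φ) (g.map ψ)

end Bilin

/-- Formal operations generated by `φ ⊗ c` and `a ⊗ ψ`. -/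
inductive TensorTerm (R S : ColoredProp.{u}) :
    Prof (R.Col × S.Col) → Prof (R.Col × S.Col) → Type u
  | left {a b : Prof R.Col} (φ : R.Hom a b) (c : S.Col) :
      TensorTerm R S (a.map fun x => (x, c)) (b.map fun x => (x, c))
  | right (a : R.Col) {c d : Prof S.Col} (ψ : S.Hom c d) :
      TensorTerm R S (c.map fun x => (a, x)) (d.map fun x => (a, x))
  | id (a) : TensorTerm R S a a
  | vcomp {a b c} (f : TensorTerm R S b c) (g : TensorTerm R S a b) : TensorTerm R S a c
  | hcomp {a b a' b'} (f : TensorTerm R S a b) (g : TensorTerm R S a' b') :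
      TensorTerm R S (a.append a') (b.append b')
  | pull {a a' b} (σ : Prof.Iso a' a) (f : TensorTerm R S a b) : TensorTerm R S a' b
  | push {a b b'} (τ : Prof.Iso b b') (f : TensorTerm R S a b) : TensorTerm R S a b'

/-- The formal operations as prop data. -/
def termData (R S : ColoredProp.{u}) : PropData.{u} where
  Col := R.Col × S.Col
  Hom := TensorTerm R S
  id := .id
  vcomp := .vcomp
  hcomp := .hcomp
  pull := .pull
  push := .push

open TensorTerm (left right) in
/-- The congruence on formal operations generated by the laws of a prop, by the conditions that
`- ⊗ c` and `a ⊗ -` are homomorphisms, and by the octagons of `φ` and `ψ`. -/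
inductive TensorRel (R S : ColoredProp.{u}) : ∀ {a b : Prof (R.Col × S.Col)},
    (termData R S).Hom a b → (termData R S).Hom a b → Prop
  | refl {a b} (f : (termData R S).Hom a b) : TensorRel R S f f
  | symm {a b} {f g : (termData R S).Hom a b} : TensorRel R S f g → TensorRel R S g f
  | trans {a b} {f g h : (termData R S).Hom a b} :
      TensorRel R S f g → TensorRel R S g h → TensorRel R S f h
  | congr_vcomp {a b c} {f f' : (termData R S).Hom b c} {g g' : (termData R S).Hom a b} :
      TensorRel R S f f' → TensorRel R S g g' →
      TensorRel R S ((termData R S).vcomp f g) ((termData R S).vcomp f' g')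
  | congr_hcomp {a b c d} {f f' : (termData R S).Hom a b} {g g' : (termData R S).Hom c d} :
      TensorRel R S f f' → TensorRel R S g g' →
      TensorRel R S ((termData R S).hcomp f g) ((termData R S).hcomp f' g')
  | congr_pull {a a' b} (σ : Prof.Iso a' a) {f f' : (termData R S).Hom a b} :
      TensorRel R S f f' → TensorRel R S ((termData R S).pull σ f) ((termData R S).pull σ f')
  | congr_push {a b b'} (τ : Prof.Iso b b') {f f' : (termData R S).Hom a b} :
      TensorRel R S f f' → TensorRel R S ((termData R S).push τ f) ((termData R S).push τ f')
  | vcomp_assoc {a b c d} (f : (termData R S).Hom c d) (g : (termData R S).Hom b c)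
      (h : (termData R S).Hom a b) :
      TensorRel R S ((termData R S).vcomp ((termData R S).vcomp f g) h)
        ((termData R S).vcomp f ((termData R S).vcomp g h))
  | id_vcomp {a b} (f : (termData R S).Hom a b) :
      TensorRel R S ((termData R S).vcomp ((termData R S).id b) f) f
  | vcomp_id {a b} (f : (termData R S).Hom a b) :
      TensorRel R S ((termData R S).vcomp f ((termData R S).id a)) f
  | id_append (a b : Prof (R.Col × S.Col)) :
      TensorRel R S ((termData R S).id (a.append b))
        ((termData R S).hcomp ((termData R S).id a) ((termData R S).id b))
  | hcomp_assoc {a b a' b' a'' b''} (f : (termData R S).Hom a b)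
      (g : (termData R S).Hom a' b') (h : (termData R S).Hom a'' b'') :
      TensorRel R S ((termData R S).act (.assoc a a' a'') (.assoc b b' b'')
          ((termData R S).hcomp ((termData R S).hcomp f g) h))
        ((termData R S).hcomp f ((termData R S).hcomp g h))
  | nil_hcomp {a b} (f : (termData R S).Hom a b) :
      TensorRel R S ((termData R S).act (.nilAppend a) (.nilAppend b)
        ((termData R S).hcomp ((termData R S).id Prof.nil) f)) f
  | hcomp_nil {a b} (f : (termData R S).Hom a b) :
      TensorRel R S ((termData R S).act (.appendNil a) (.appendNil b)
        ((termData R S).hcomp f ((termData R S).id Prof.nil))) f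
  | hcomp_vcomp {a b c a' b' c'} (f : (termData R S).Hom b c) (g : (termData R S).Hom a b)
      (f' : (termData R S).Hom b' c') (g' : (termData R S).Hom a' b') :
      TensorRel R S
        ((termData R S).hcomp ((termData R S).vcomp f g) ((termData R S).vcomp f' g'))
        ((termData R S).vcomp ((termData R S).hcomp f f') ((termData R S).hcomp g g'))
  | vcomp_push {a b b' c} (f : (termData R S).Hom b' c) (σ : Prof.Iso b b')
      (g : (termData R S).Hom a b) :
      TensorRel R S ((termData R S).vcomp f ((termData R S).push σ g))
        ((termData R S).vcomp ((termData R S).pull σ f) g)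
  | pull_vcomp {a a' b c} (σ : Prof.Iso a' a) (f : (termData R S).Hom b c)
      (g : (termData R S).Hom a b) :
      TensorRel R S ((termData R S).pull σ ((termData R S).vcomp f g))
        ((termData R S).vcomp f ((termData R S).pull σ g))
  | push_vcomp {a b c c'} (τ : Prof.Iso c c') (f : (termData R S).Hom b c)
      (g : (termData R S).Hom a b) :
      TensorRel R S ((termData R S).push τ ((termData R S).vcomp f g))
        ((termData R S).vcomp ((termData R S).push τ f) g)
  | hcomp_pull {a b c a' b' c'} (σ : Prof.Iso a b) (σ' : Prof.Iso a' b')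
      (f : (termData R S).Hom b c) (g : (termData R S).Hom b' c') :
      TensorRel R S
        ((termData R S).hcomp ((termData R S).pull σ f) ((termData R S).pull σ' g))
        ((termData R S).pull (σ.append σ') ((termData R S).hcomp f g))
  | hcomp_push {a b c a' b' c'} (τ : Prof.Iso b c) (τ' : Prof.Iso b' c')
      (f : (termData R S).Hom a b) (g : (termData R S).Hom a' b') :
      TensorRel R S
        ((termData R S).hcomp ((termData R S).push τ f) ((termData R S).push τ' g))
        ((termData R S).push (τ.append τ') ((termData R S).hcomp f g))
  | hcomp_swap {a b a' b'} (f : (termData R S).Hom a b) (g : (termData R S).Hom a' b') :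
      TensorRel R S ((termData R S).pull (.swap a' a)
        ((termData R S).push (.swap b b') ((termData R S).hcomp f g)))
        ((termData R S).hcomp g f)
  | pull_push {a a' b b'} (σ : Prof.Iso a' a) (τ : Prof.Iso b b')
      (f : (termData R S).Hom a b) :
      TensorRel R S ((termData R S).pull σ ((termData R S).push τ f))
        ((termData R S).push τ ((termData R S).pull σ f))
  | pull_pull {a a' a'' b} (σ' : Prof.Iso a'' a') (σ : Prof.Iso a' a)
      (f : (termData R S).Hom a b) :
      TensorRel R S ((termData R S).pull σ' ((termData R S).pull σ f))
        ((termData R S).pull (σ'.trans σ) f)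
  | push_push {a b b' b''} (τ' : Prof.Iso b' b'') (τ : Prof.Iso b b')
      (f : (termData R S).Hom a b) :
      TensorRel R S ((termData R S).push τ' ((termData R S).push τ f))
        ((termData R S).push (τ.trans τ') f)
  | pull_refl {a b} (f : (termData R S).Hom a b) :
      TensorRel R S ((termData R S).pull (.refl a) f) f
  | push_refl {a b} (f : (termData R S).Hom a b) :
      TensorRel R S ((termData R S).push (.refl b) f) f
  | left_id (a : Prof R.Col) (c : S.Col) :
      TensorRel R S (left (R.id a) c) ((termData R S).id (a.map fun x => (x, c)))
  | left_vcomp {a b d} (f : R.Hom b d) (g : R.Hom a b) (c : S.Col) :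
      TensorRel R S (left (R.vcomp f g) c) ((termData R S).vcomp (left f c) (left g c))
  | left_hcomp {a b a' b'} (f : R.Hom a b) (g : R.Hom a' b') (c : S.Col) :
      TensorRel R S (left (R.hcomp f g) c)
        ((termData R S).act (.mapAppend (fun x => (x, c)) a a')
          (.mapAppend (fun x => (x, c)) b b') ((termData R S).hcomp (left f c) (left g c)))
  | left_pull {a a' b} (σ : Prof.Iso a' a) (f : R.Hom a b) (c : S.Col) :
      TensorRel R S (left (R.pull σ f) c)
        ((termData R S).pull (σ.map fun x => (x, c)) (left f c))
  | left_push {a b b'} (τ : Prof.Iso b b') (f : R.Hom a b) (c : S.Col) :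
      TensorRel R S (left (R.push τ f) c)
        ((termData R S).push (τ.map fun x => (x, c)) (left f c))
  | right_id (a : R.Col) (c : Prof S.Col) :
      TensorRel R S (right a (S.id c)) ((termData R S).id (c.map fun x => (a, x)))
  | right_vcomp (a : R.Col) {c d e} (f : S.Hom d e) (g : S.Hom c d) :
      TensorRel R S (right a (S.vcomp f g)) ((termData R S).vcomp (right a f) (right a g))
  | right_hcomp (a : R.Col) {c d c' d'} (f : S.Hom c d) (g : S.Hom c' d') :
      TensorRel R S (right a (S.hcomp f g))
        ((termData R S).act (.mapAppend (fun x => (a, x)) c c')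
          (.mapAppend (fun x => (a, x)) d d') ((termData R S).hcomp (right a f) (right a g)))
  | right_pull (a : R.Col) {c c' d} (σ : Prof.Iso c' c) (f : S.Hom c d) :
      TensorRel R S (right a (S.pull σ f))
        ((termData R S).pull (σ.map fun x => (a, x)) (right a f))
  | right_push (a : R.Col) {c d d'} (τ : Prof.Iso d d') (f : S.Hom c d) :
      TensorRel R S (right a (S.push τ f))
        ((termData R S).push (τ.map fun x => (a, x)) (right a f))
  | octagon {a b : Prof R.Col} (φ : R.Hom a b) {c d : Prof S.Col} (ψ : S.Hom c d) :
      TensorRel R S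
        ((termData R S).octagonTop (A := fun j i => (a.get i, c.get j))
          (A' := fun j k => (b.get k, c.get j)) (B' := fun l k => (b.get k, d.get l))
          (fun j => left φ (c.get j)) (fun k => right (b.get k) ψ))
        ((termData R S).octagonBottom (A := fun j i => (a.get i, c.get j))
          (B := fun l i => (a.get i, d.get l)) (B' := fun l k => (b.get k, d.get l))
          (fun l => left φ (d.get l)) (fun i => right (a.get i) ψ))

/-- The congruence as a setoid. -/
def tensorSetoid (R S : ColoredProp.{u}) (a b : Prof (R.Col × S.Col)) :
    Setoid ((termData R S).Hom a b) :=
  ⟨TensorRel R S, .refl, .symm, .trans⟩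

/-- The operations of the tensor product. -/
def tensorData (R S : ColoredProp.{u}) : PropData.{u} where
  Col := R.Col × S.Col
  Hom a b := Quotient (tensorSetoid R S a b)
  id a := Quotient.mk _ ((termData R S).id a)
  vcomp := Quotient.map₂ (termData R S).vcomp fun _ _ h _ _ h' => .congr_vcomp h h'
  hcomp := Quotient.map₂ (termData R S).hcomp fun _ _ h _ _ h' => .congr_hcomp h h'
  pull σ := Quotient.map ((termData R S).pull σ) fun _ _ h => .congr_pull σ h
  push τ := Quotient.map ((termData R S).push τ) fun _ _ h => .congr_push τ h

/-- The tensor product `R ⊗ S`: the prop with colours `Col R × Col S` presented by the generators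
`φ ⊗ c` and `a ⊗ ψ` and the relations making `(R, S) → R ⊗ S` a bilinear map. -/
def tensor (R S : ColoredProp.{u}) : ColoredProp.{u} where
  toPropData := tensorData R S
  vcomp_assoc := by rintro _ _ _ _ ⟨f⟩ ⟨g⟩ ⟨h⟩; exact Quotient.sound (.vcomp_assoc f g h)
  id_vcomp := by rintro _ _ ⟨f⟩; exact Quotient.sound (.id_vcomp f)
  vcomp_id := by rintro _ _ ⟨f⟩; exact Quotient.sound (.vcomp_id f)
  id_append a b := Quotient.sound (.id_append a b)
  hcomp_assoc := by rintro _ _ _ _ _ _ ⟨f⟩ ⟨g⟩ ⟨h⟩; exact Quotient.sound (.hcomp_assoc f g h)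
  nil_hcomp := by rintro _ _ ⟨f⟩; exact Quotient.sound (.nil_hcomp f)
  hcomp_nil := by rintro _ _ ⟨f⟩; exact Quotient.sound (.hcomp_nil f)
  hcomp_vcomp := by
    rintro _ _ _ _ _ _ ⟨f⟩ ⟨g⟩ ⟨f'⟩ ⟨g'⟩; exact Quotient.sound (.hcomp_vcomp f g f' g')
  vcomp_push := by rintro _ _ _ _ ⟨f⟩ σ ⟨g⟩; exact Quotient.sound (.vcomp_push f σ g)
  pull_vcomp := by rintro _ _ _ _ σ ⟨f⟩ ⟨g⟩; exact Quotient.sound (.pull_vcomp σ f g)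
  push_vcomp := by rintro _ _ _ _ σ ⟨f⟩ ⟨g⟩; exact Quotient.sound (.push_vcomp σ f g)
  hcomp_pull := by rintro _ _ _ _ _ _ σ τ ⟨f⟩ ⟨g⟩; exact Quotient.sound (.hcomp_pull σ τ f g)
  hcomp_push := by rintro _ _ _ _ _ _ σ τ ⟨f⟩ ⟨g⟩; exact Quotient.sound (.hcomp_push σ τ f g)
  hcomp_swap := by rintro _ _ _ _ ⟨f⟩ ⟨g⟩; exact Quotient.sound (.hcomp_swap f g)
  pull_push := by rintro _ _ _ _ σ τ ⟨f⟩; exact Quotient.sound (.pull_push σ τ f)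
  pull_pull := by rintro _ _ _ _ σ τ ⟨f⟩; exact Quotient.sound (.pull_pull σ τ f)
  push_push := by rintro _ _ _ _ σ τ ⟨f⟩; exact Quotient.sound (.push_push σ τ f)
  pull_refl := by rintro _ _ ⟨f⟩; exact Quotient.sound (.pull_refl f)
  push_refl := by rintro _ _ ⟨f⟩; exact Quotient.sound (.push_refl f)

theorem tensor_hprod (R S : ColoredProp.{u}) {n : ℕ} {P Q : Fin n → Prof (R.Col × S.Col)}
    (f : ∀ i, (termData R S).Hom (P i) (Q i)) :
    (tensor R S).hprod (fun i => Quotient.mk (tensorSetoid R S _ _) (f i))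
      = Quotient.mk (tensorSetoid R S _ _) ((termData R S).hprod f) := by
  induction n with
  | zero => rfl
  | succ n ih => exact congrArg ((tensor R S).hcomp _) (ih fun i => f i.succ)

/-- The universal bilinear map `(R, S) → R ⊗ S`. -/
def tensorMk (R S : ColoredProp.{u}) : Bilin R S (tensor R S) where
  col a c := (a, c)
  left φ c := Quotient.mk _ (TensorTerm.left φ c)
  right a _ _ ψ := Quotient.mk _ (TensorTerm.right a ψ)
  left_isHom c :=
    { map_id a := Quotient.sound (.left_id a c)
      map_vcomp f g := Quotient.sound (.left_vcomp f g c)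
      map_hcomp f g := Quotient.sound (.left_hcomp f g c)
      map_pull σ f := Quotient.sound (.left_pull σ f c)
      map_push σ f := Quotient.sound (.left_push σ f c) }
  right_isHom a :=
    { map_id c := Quotient.sound (.right_id a c)
      map_vcomp f g := Quotient.sound (.right_vcomp a f g)
      map_hcomp f g := Quotient.sound (.right_hcomp a f g)
      map_pull σ f := Quotient.sound (.right_pull a σ f)
      map_push σ f := Quotient.sound (.right_push a σ f) }
  octagon {a b} φ {c d} ψ := by
    have h1 := tensor_hprod R S fun j => TensorTerm.left φ (c.get j)
    have h2 := tensor_hprod R S fun l => TensorTerm.left φ (d.get l)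
    have h3 := tensor_hprod R S fun i => TensorTerm.right (a.get i) ψ
    have h4 := tensor_hprod R S fun k => TensorTerm.right (b.get k) ψ
    unfold PropData.Octagon PropData.octagonTop PropData.octagonBottom
    erw [h1, h2, h3, h4]
    exact Quotient.sound (.octagon φ ψ)

section Lift

variable {R S T : ColoredProp.{u}}

/-- Evaluation of formal operations along a bilinear map. -/
def TensorTerm.eval (β : Bilin R S T) : ∀ {a b : Prof (R.Col × S.Col)}, TensorTerm R S a b →
    T.Hom (a.map fun x => β.col x.1 x.2) (b.map fun x => β.col x.1 x.2)
  | _, _, .left φ c => β.left φ c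
  | _, _, .right a ψ => β.right a ψ
  | _, _, .id _ => T.id _
  | _, _, .vcomp f g => T.vcomp (TensorTerm.eval β f) (TensorTerm.eval β g)
  | _, _, .hcomp f g => T.act (.mapAppend _ _ _) (.mapAppend _ _ _) (T.hcomp (TensorTerm.eval β f) (TensorTerm.eval β g))
  | _, _, .pull σ f => T.pull (σ.map _) (TensorTerm.eval β f)
  | _, _, .push τ f => T.push (τ.map _) (TensorTerm.eval β f)

theorem eval_isHom (β : Bilin R S T) :
    IsPropHom (termData R S) T.toPropData (fun x => β.col x.1 x.2)
      (fun f => TensorTerm.eval β f) where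
  map_id _ := rfl
  map_vcomp _ _ := rfl
  map_hcomp _ _ := rfl
  map_pull _ _ := rfl
  map_push _ _ := rfl

theorem eval_act (β : Bilin R S T) {a a' b b' : Prof (R.Col × S.Col)} (σ : Prof.Iso a a')
    (τ : Prof.Iso b b') (f : TensorTerm R S a b) :
    TensorTerm.eval β ((termData R S).act σ τ f)
      = T.act (σ.map _) (τ.map _) (TensorTerm.eval β f) :=
  (eval_isHom β).map_act σ τ f

theorem eval_rel (β : Bilin R S T) {a b : Prof (R.Col × S.Col)} {f g : (termData R S).Hom a b}
    (h : TensorRel R S f g) : TensorTerm.eval β f = TensorTerm.eval β g := by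
  induction h with
  | refl f => rfl
  | symm _ ih => exact ih.symm
  | trans _ _ ih ih' => exact ih.trans ih'
  | congr_vcomp _ _ ih ih' => exact congrArg₂ T.vcomp ih ih'
  | congr_hcomp _ _ ih ih' => exact congrArg (T.act _ _) (congrArg₂ T.hcomp ih ih')
  | congr_pull σ _ ih => exact congrArg (T.pull _) ih
  | congr_push τ _ ih => exact congrArg (T.push _) ih
  | vcomp_assoc f g h => exact T.vcomp_assoc _ _ _
  | id_vcomp f => exact T.id_vcomp _
  | vcomp_id f => exact T.vcomp_id _
  | id_append a b => exact comp_id_append T _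
  | hcomp_assoc f g h =>
    exact (eval_act β _ _ _).trans (comp_hcomp_assoc T _ _ _ _)
  | nil_hcomp f => exact (eval_act β _ _ _).trans (comp_nil_hcomp T _ _)
  | hcomp_nil f => exact (eval_act β _ _ _).trans (comp_hcomp_nil T _ _)
  | hcomp_vcomp f g f' g' => exact comp_hcomp_vcomp T _ _ _ _ _
  | vcomp_push f σ g => exact T.vcomp_push _ _ _
  | pull_vcomp σ f g => exact T.pull_vcomp _ _ _
  | push_vcomp τ f g => exact T.push_vcomp _ _ _
  | hcomp_pull σ σ' f g => exact comp_hcomp_pull T _ _ _ _ _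
  | hcomp_push τ τ' f g => exact comp_hcomp_push T _ _ _ _ _
  | hcomp_swap f g => exact comp_hcomp_swap T _ _ _
  | pull_push σ τ f => exact T.pull_push _ _ _
  | pull_pull σ' σ f => exact T.pull_pull _ _ _
  | push_push τ' τ f => exact T.push_push _ _ _
  | pull_refl f => exact T.pull_refl _
  | push_refl f => exact T.push_refl _
  | left_id a c => exact (β.left_isHom c).map_id a
  | left_vcomp f g c => exact (β.left_isHom c).map_vcomp f g
  | @left_hcomp a b a' b' f g c =>
    refine ((β.left_isHom c).map_hcomp f g).trans (Eq.trans ?_ (eval_act β (.mapAppend (fun x => (x, c)) a a')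
      (.mapAppend (fun x => (x, c)) b b')
      ((termData R S).hcomp (TensorTerm.left f c) (TensorTerm.left g c))).symm)
    exact (T.act_act
      (.mapAppend (fun x : R.Col × S.Col => β.col x.1 x.2) (a.map (fun x => (x, c))) (a'.map (fun x => (x, c))))
      ((Prof.Iso.mapAppend (fun x => (x, c)) a a').map fun x : R.Col × S.Col => β.col x.1 x.2)
      (.mapAppend (fun x : R.Col × S.Col => β.col x.1 x.2) (b.map (fun x => (x, c))) (b'.map (fun x => (x, c))))
      ((Prof.Iso.mapAppend (fun x => (x, c)) b b').map fun x : R.Col × S.Col => β.col x.1 x.2)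
      (T.hcomp (β.left f c) (β.left g c))).symm
  | left_pull σ f c => exact (β.left_isHom c).map_pull σ f
  | left_push τ f c => exact (β.left_isHom c).map_push τ f
  | right_id a c => exact (β.right_isHom a).map_id c
  | right_vcomp a f g => exact (β.right_isHom a).map_vcomp f g
  | @right_hcomp a c d c' d' f g =>
    refine ((β.right_isHom a).map_hcomp f g).trans (Eq.trans ?_ (eval_act β (.mapAppend (fun x => (a, x)) c c')
      (.mapAppend (fun x => (a, x)) d d')
      ((termData R S).hcomp (TensorTerm.right a f) (TensorTerm.right a g))).symm)
    exact (T.act_act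
      (.mapAppend (fun x : R.Col × S.Col => β.col x.1 x.2) (c.map (fun x => (a, x))) (c'.map (fun x => (a, x))))
      ((Prof.Iso.mapAppend (fun x => (a, x)) c c').map fun x : R.Col × S.Col => β.col x.1 x.2)
      (.mapAppend (fun x : R.Col × S.Col => β.col x.1 x.2) (d.map (fun x => (a, x))) (d'.map (fun x => (a, x))))
      ((Prof.Iso.mapAppend (fun x => (a, x)) d d').map fun x : R.Col × S.Col => β.col x.1 x.2)
      (T.hcomp (β.right a f) (β.right a g))).symm
  | right_pull a σ f => exact (β.right_isHom a).map_pull σ f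
  | right_push a τ f => exact (β.right_isHom a).map_push τ f
  | octagon φ ψ => exact map_octagon_of (eval_isHom β) (β.octagon φ ψ)

/-- The homomorphism `R ⊗ S → T` induced by a bilinear map `(R, S) → T`. -/
def lift (β : Bilin R S T) : PropHom (tensor R S) T where
  col x := β.col x.1 x.2
  map := Quotient.lift (TensorTerm.eval β) fun _ _ h => eval_rel β h
  isHom :=
    { map_id _ := rfl
      map_vcomp := by rintro _ _ _ ⟨f⟩ ⟨g⟩; rfl
      map_hcomp := by rintro _ _ _ _ ⟨f⟩ ⟨g⟩; rfl
      map_pull := by rintro _ _ _ σ ⟨f⟩; rfl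
      map_push := by rintro _ _ _ τ ⟨f⟩; rfl }

/-- The tensor product of homomorphisms. -/
def tensorMap {R' S' : ColoredProp.{u}} (f : PropHom R' R) (g : PropHom S' S) :
    PropHom (tensor R' S') (tensor R S) :=
  lift ((tensorMk R S).pre f g)

/-- The homomorphism `R → Hom(S, T)`, `a ↦ g(a ⊗ -)`, `φ ↦ (g(φ ⊗ c))_c`, that corresponds to
`g : R ⊗ S → T`. -/
def curry (g : PropHom (tensor R S) T) : PropHom R (ihom S T) :=
  ((tensorMk R S).comp g).toHom

end Lift

end ColoredProp

open CategoryTheory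

/-! An operation of `Hom(R ⊗ S, T)` and an operation of `Hom(R, Hom(S, T))` are both families of
operations `ξ_{(a, c)}` of `T`, indexed by the colours `a` of `R` and `c` of `S`; what has to be
compared are the naturality conditions. On the left, `ξ` is natural with respect to all operations
of `R ⊗ S`. On the right, naturality of `ξ_{(a, -)}` is naturality of `ξ` with respect to the
generators `a ⊗ ψ`, and naturality of `a ↦ ξ_{(a, -)}` is naturality with respect to the generators
`φ ⊗ c`: evaluation at `c` is a homomorphism `Hom(S, T) → T` (`evalAt`), and an octagon in
`Hom(S, T)` commutes if and only if all its evaluations do. So the two conditions agree once it is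
known that the operations with respect to which a given family is natural are closed under
identities, both compositions and the symmetric group actions (`NaturalAt.id`, `NaturalAt.vcomp`,
`NaturalAt.hcomp`, `NaturalAt.act`), since these generate `R ⊗ S` (`naturalAt_tensor`).

On colours, the inverse of `curry` sends `h : R → Hom(S, T)` to the homomorphism induced by the
bilinear map `(φ, c) ↦ (hφ)_c`, `(a, ψ) ↦ (h a)ψ` (`Bilin.ofHom`); that it is inverse to `curry` is
the uniqueness part of the universal property of `R ⊗ S` (`lift_comp`). -/

namespace ColoredProp

/-! ### Operations with respect to which a family is natural -/

namespace NatTrans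

variable {R T : ColoredProp.{u}}

/-- The family `app` is natural with respect to the operation `φ`. -/
def NaturalAt {fs gs : Prof (PropHom R T)}
    (app : ∀ a : R.Col, T.Hom (fs.map fun f => f.col a) (gs.map fun g => g.col a))
    {a b : Prof R.Col} (φ : R.Hom a b) : Prop :=
  T.vcomp (T.hprod fun l => (gs.get l).map φ)
      (T.act (ic fs a) (ic gs a) (T.hprod fun i => app (a.get i)))
    = T.vcomp (T.act (ic fs b) (ic gs b) (T.hprod fun k => app (b.get k)))
      (T.hprod fun j => (fs.get j).map φ)

theorem naturalAt_iff {fs gs : Prof (PropHom R T)}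
    {app : ∀ a : R.Col, T.Hom (fs.map fun f => f.col a) (gs.map fun g => g.col a)}
    {a b : Prof R.Col} {φ : R.Hom a b} : NaturalAt app φ ↔
      T.Octagon (fun i => app (a.get i)) (fun k => app (b.get k))
        (fun j => (fs.get j).map φ) (fun l => (gs.get l).map φ) :=
  (T.octagon_iff _ _ _ _).symm

/-- Bijections of lists of colours act on rows. -/
def rowIso (fs : Prof (PropHom R T)) {a b : Prof R.Col} (σ : Prof.Iso a b) :
    Prof.Iso (Prof.flat fun i => fs.map fun f => f.col (a.get i))
      (Prof.flat fun i => fs.map fun f => f.col (b.get i)) :=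
  Prof.flatIso (show (Σ _ : Fin a.len, Fin fs.len) ≃ (Σ _ : Fin b.len, Fin fs.len) from
    ⟨fun x => ⟨σ.toEquiv x.1, x.2⟩, fun x => ⟨σ.toEquiv.symm x.1, x.2⟩,
      fun x => by simp, fun x => by simp⟩)
    fun i j => congrArg (fs.get j).col (σ.get_eq i)

theorem rowIso_idx (fs : Prof (PropHom R T)) {a b : Prof R.Col} (σ : Prof.Iso a b) (i j) :
    (rowIso fs σ).toEquiv (Prof.idx _ ⟨i, j⟩) = Prof.idx _ ⟨σ.toEquiv i, j⟩ :=
  Prof.flatIso_idx _ _ _ _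

/-- Permuting the colours permutes the components of a family. This is `col_act` with the roles of
colours and homomorphisms exchanged. -/
theorem row_act {fs gs : Prof (PropHom R T)}
    (app : ∀ a : R.Col, T.Hom (fs.map fun f => f.col a) (gs.map fun g => g.col a))
    {a b : Prof R.Col} (σ : Prof.Iso a b) :
    T.hprod (fun i => app (b.get i))
      = T.act (rowIso fs σ) (rowIso gs σ) (T.hprod fun i => app (a.get i)) := by
  obtain ⟨n, x⟩ := a
  obtain ⟨m, y⟩ := b
  obtain ⟨e, he⟩ := σ
  change Fin n ≃ Fin m at e
  obtain rfl : n = m := Fin.equiv_iff_eq.1 ⟨e⟩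
  obtain rfl : (fun i => y (e i)) = x := funext he
  refine (T.hprod_perm e _).trans (T.act_congr ?_ ?_ rfl)
  · refine Prof.flat_ext fun i j => ?_
    exact (Prof.flatPerm_idx e (fun i => fs.map fun f => f.col (y i)) i j).trans
      (rowIso_idx fs (a := ⟨n, fun i => y (e i)⟩) (b := ⟨n, y⟩) ⟨e, he⟩ i j).symm
  · refine Prof.flat_ext fun i j => ?_
    exact (Prof.flatPerm_idx e (fun i => gs.map fun f => f.col (y i)) i j).trans
      (rowIso_idx gs (a := ⟨n, fun i => y (e i)⟩) (b := ⟨n, y⟩) ⟨e, he⟩ i j).symm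

theorem rowIso_ic (fs : Prof (PropHom R T)) {a b : Prof R.Col} (σ : Prof.Iso a b) :
    (rowIso fs σ).trans (ic fs b)
      = (ic fs a).trans (Prof.flatCongr fun j => σ.map (fs.get j).col) := by
  refine Prof.flat_ext fun i j => ?_
  have h1 := congrArg (ic fs b).toEquiv (rowIso_idx fs σ i j)
  have h2 := congrArg (Prof.flatCongr fun j => σ.map (fs.get j).col).toEquiv (ic_idx fs a i j)
  exact h1.trans ((ic_idx fs b (σ.toEquiv i) j).trans
    ((Prof.flatCongr_idx (fun j => σ.map (fs.get j).col) j i).symm.trans h2.symm))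

/-- Equal colours have equal rows. -/
def rowEq (fs : Prof (PropHom R T)) {x y : R.Col} (h : x = y) :
    Prof.Iso (fs.map fun f => f.col x) (fs.map fun f => f.col y) :=
  ⟨Equiv.refl _, fun i => congrArg (fs.get i).col h.symm⟩

theorem app_eq {fs gs : Prof (PropHom R T)}
    (app : ∀ a : R.Col, T.Hom (fs.map fun f => f.col a) (gs.map fun g => g.col a))
    {x y : R.Col} (h : x = y) : T.act (rowEq fs h) (rowEq gs h) (app x) = app y := by
  subst h
  exact T.act_refl _

/-- Rows of a concatenated list of colours. -/
def rowAppend (fs : Prof (PropHom R T)) (a b : Prof R.Col) :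
    Prof.Iso ((Prof.flat fun i => fs.map fun f => f.col (a.get i)).append
        (Prof.flat fun i => fs.map fun f => f.col (b.get i)))
      (Prof.flat fun i => fs.map fun f => f.col ((a.append b).get i)) :=
  (Prof.Iso.append
    (Prof.flatCongr fun i => rowEq fs (Prof.get_inl a b i).symm)
    (Prof.flatCongr fun i => rowEq fs (Prof.get_inr a b i).symm)).trans
    (Prof.flatPos a b fun i => fs.map fun f => f.col ((a.append b).get i))

theorem rowAppend_inl (fs : Prof (PropHom R T)) (a b : Prof R.Col) (i j) :
    (rowAppend fs a b).toEquiv (Prof.inl _ _ (Prof.idx _ ⟨i, j⟩))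
      = Prof.idx (fun i => fs.map fun f => f.col ((a.append b).get i)) ⟨a.inl b i, j⟩ := by
  unfold rowAppend
  rw [Prof.Iso.trans_toEquiv, Equiv.trans_apply, Prof.Iso.append_inl, Prof.flatCongr_idx]
  exact Prof.flatPos_inl a b (fun i => fs.map fun f => f.col ((a.append b).get i)) i j

theorem rowAppend_inr (fs : Prof (PropHom R T)) (a b : Prof R.Col) (i j) :
    (rowAppend fs a b).toEquiv (Prof.inr _ _ (Prof.idx _ ⟨i, j⟩))
      = Prof.idx (fun i => fs.map fun f => f.col ((a.append b).get i)) ⟨a.inr b i, j⟩ := by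
  unfold rowAppend
  rw [Prof.Iso.trans_toEquiv, Equiv.trans_apply, Prof.Iso.append_inr, Prof.flatCongr_idx]
  exact Prof.flatPos_inr a b (fun i => fs.map fun f => f.col ((a.append b).get i)) i j

theorem row_append {fs gs : Prof (PropHom R T)}
    (app : ∀ a : R.Col, T.Hom (fs.map fun f => f.col a) (gs.map fun g => g.col a))
    (a b : Prof R.Col) :
    T.hprod (fun i => app ((a.append b).get i))
      = T.act (rowAppend fs a b) (rowAppend gs a b)
        (T.hcomp (T.hprod fun i => app (a.get i)) (T.hprod fun i => app (b.get i))) := by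
  refine (T.hprod_pos a b fun i => app ((a.append b).get i)).trans ?_
  unfold rowAppend
  rw [← T.act_act, ← T.hcomp_act, ← T.hprod_act, ← T.hprod_act]
  refine T.act_congr rfl rfl (congrArg₂ T.hcomp (congrArg T.hprod (funext fun i => ?_))
    (congrArg T.hprod (funext fun i => ?_)))
  · exact (app_eq app (Prof.get_inl a b i).symm).symm
  · exact (app_eq app (Prof.get_inr a b i).symm).symm

/-- The values of a list of homomorphisms on a concatenated list of colours. -/
def colsAppend (fs : Prof (PropHom R T)) (a b : Prof R.Col) :
    Prof.Iso ((Prof.flat fun j => a.map (fs.get j).col).append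
        (Prof.flat fun j => b.map (fs.get j).col))
      (Prof.flat fun j => (a.append b).map (fs.get j).col) :=
  (Prof.flatAppend _ _).trans (Prof.flatCongr fun j => Prof.Iso.mapAppend (fs.get j).col a b)

theorem rowAppend_ic (fs : Prof (PropHom R T)) (a b : Prof R.Col) :
    (rowAppend fs a b).trans (ic fs (a.append b))
      = ((ic fs a).append (ic fs b)).trans (colsAppend fs a b) := by
  refine Prof.flat_append_ext (fun i j => ?_) (fun i j => ?_)
  · simp only [Prof.Iso.trans_toEquiv, Equiv.trans_apply, Prof.Iso.append_inl, rowAppend_inl,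
      ic_idx, colsAppend, Prof.flatAppend_inl, Prof.flatCongr_idx]
    rfl
  · simp only [Prof.Iso.trans_toEquiv, Equiv.trans_apply, Prof.Iso.append_inr, rowAppend_inr,
      ic_idx, colsAppend, Prof.flatAppend_inr, Prof.flatCongr_idx]
    rfl

theorem hprod_map_hcomp (fs : Prof (PropHom R T)) {a b a' b' : Prof R.Col} (φ : R.Hom a b)
    (φ' : R.Hom a' b') :
    T.hprod (fun j => (fs.get j).map (R.hcomp φ φ'))
      = T.act (colsAppend fs a a') (colsAppend fs b b')
        (T.hcomp (T.hprod fun j => (fs.get j).map φ) (T.hprod fun j => (fs.get j).map φ')) := by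
  refine (congrArg T.hprod (funext fun j => (fs.get j).isHom.map_hcomp φ φ')).trans ?_
  rw [T.hprod_act, T.hprod_hcomp, T.act_act]
  rfl

theorem hprod_map_act (fs : Prof (PropHom R T)) {a a' b b' : Prof R.Col} (σ : Prof.Iso a a')
    (τ : Prof.Iso b b') (φ : R.Hom a b) :
    T.hprod (fun j => (fs.get j).map (R.act σ τ φ))
      = T.act (Prof.flatCongr fun j => σ.map (fs.get j).col)
        (Prof.flatCongr fun j => τ.map (fs.get j).col) (T.hprod fun j => (fs.get j).map φ) := by
  refine (congrArg T.hprod (funext fun j => (fs.get j).isHom.map_act σ τ φ)).trans ?_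
  exact T.hprod_act _ _ _

namespace NaturalAt

variable {fs gs : Prof (PropHom R T)}
  {app : ∀ a : R.Col, T.Hom (fs.map fun f => f.col a) (gs.map fun g => g.col a)}

theorem id (a : Prof R.Col) : NaturalAt app (R.id a) := by
  have key : ∀ hs : Prof (PropHom R T), T.hprod (fun j => (hs.get j).map (R.id a))
      = T.id (Prof.flat fun j => a.map (hs.get j).col) := fun hs =>
    (congrArg T.hprod (funext fun j => (hs.get j).isHom.map_id a)).trans (T.hprod_id _)
  unfold NaturalAt
  rw [key, key, T.id_vcomp, T.vcomp_id]

theorem vcomp {a b c : Prof R.Col} {φ : R.Hom b c} {φ' : R.Hom a b} (h : NaturalAt app φ)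
    (h' : NaturalAt app φ') : NaturalAt app (R.vcomp φ φ') := by
  have key : ∀ hs : Prof (PropHom R T), T.hprod (fun j => (hs.get j).map (R.vcomp φ φ'))
      = T.vcomp (T.hprod fun j => (hs.get j).map φ) (T.hprod fun j => (hs.get j).map φ') :=
    fun hs => (congrArg T.hprod (funext fun j => (hs.get j).isHom.map_vcomp φ φ')).trans
      (T.hprod_vcomp _ _)
  unfold NaturalAt at *
  rw [key, key, T.vcomp_assoc, h', ← T.vcomp_assoc, h, T.vcomp_assoc]

theorem act {a a' b b' : Prof R.Col} (σ : Prof.Iso a a') (τ : Prof.Iso b b') {φ : R.Hom a b}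
    (h : NaturalAt app φ) : NaturalAt app (R.act σ τ φ) := by
  have key : ∀ {a b : Prof R.Col} (σ : Prof.Iso a b),
      T.act (ic fs b) (ic gs b) (T.hprod fun i => app (b.get i))
        = T.act (Prof.flatCongr fun j => σ.map (fs.get j).col)
          (Prof.flatCongr fun j => σ.map (gs.get j).col)
          (T.act (ic fs a) (ic gs a) (T.hprod fun i => app (a.get i))) := fun σ => by
    rw [row_act app σ, T.act_act, T.act_act]
    exact T.act_congr (rowIso_ic fs σ) (rowIso_ic gs σ) rfl
  unfold NaturalAt at *
  rw [hprod_map_act, hprod_map_act, key σ, key τ, T.vcomp_act, T.vcomp_act, h]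

theorem pull {a a' b : Prof R.Col} (σ : Prof.Iso a' a) {φ : R.Hom a b} (h : NaturalAt app φ) :
    NaturalAt app (R.pull σ φ) :=
  R.pull_eq σ φ ▸ h.act σ.symm (.refl b)

theorem push {a b b' : Prof R.Col} (τ : Prof.Iso b b') {φ : R.Hom a b} (h : NaturalAt app φ) :
    NaturalAt app (R.push τ φ) :=
  R.push_eq τ φ ▸ h.act (.refl a) τ

theorem hcomp {a b a' b' : Prof R.Col} {φ : R.Hom a b} {φ' : R.Hom a' b'} (h : NaturalAt app φ)
    (h' : NaturalAt app φ') : NaturalAt app (R.hcomp φ φ') := by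
  have key : ∀ a a' : Prof R.Col,
      T.act (ic fs (a.append a')) (ic gs (a.append a'))
          (T.hprod fun i => app ((a.append a').get i))
        = T.act (colsAppend fs a a') (colsAppend gs a a')
          (T.hcomp (T.act (ic fs a) (ic gs a) (T.hprod fun i => app (a.get i)))
            (T.act (ic fs a') (ic gs a') (T.hprod fun i => app (a'.get i)))) := fun a a' => by
    rw [row_append app a a', T.act_act, T.hcomp_act, T.act_act]
    exact T.act_congr (rowAppend_ic fs a a') (rowAppend_ic gs a a') rfl
  unfold NaturalAt at *
  rw [hprod_map_hcomp, hprod_map_hcomp, key, key, T.vcomp_act, T.vcomp_act, ← T.hcomp_vcomp,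
    ← T.hcomp_vcomp, h, h']

end NaturalAt

end NatTrans

/-! ### Generators of the tensor product -/

section Tensor

variable {R S T : ColoredProp.{u}}

/-- A family that is natural with respect to the generators `φ ⊗ c` and `a ⊗ ψ` is natural with
respect to all operations of `R ⊗ S`. -/
theorem naturalAt_tensor {fs gs : Prof (PropHom (tensor R S) T)}
    {app : ∀ x : (tensor R S).Col, T.Hom (fs.map fun f => f.col x) (gs.map fun g => g.col x)}
    (hl : ∀ {a b : Prof R.Col} (φ : R.Hom a b) (c : S.Col),
      NatTrans.NaturalAt app ((tensorMk R S).left φ c))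
    (hr : ∀ (a : R.Col) {c d : Prof S.Col} (ψ : S.Hom c d),
      NatTrans.NaturalAt app ((tensorMk R S).right a ψ))
    {a b : Prof (R.Col × S.Col)} (φ : (tensor R S).Hom a b) : NatTrans.NaturalAt app φ := by
  obtain ⟨f⟩ := φ
  clear φ
  induction f with
  | left φ c => exact hl φ c
  | right a ψ => exact hr a ψ
  | id a => exact NatTrans.NaturalAt.id (R := tensor R S) a
  | vcomp f g ihf ihg => exact ihf.vcomp ihg
  | hcomp f g ihf ihg => exact ihf.hcomp ihg
  | pull σ f ih => exact ih.pull σ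
  | push τ f ih => exact ih.push τ

/-- A homomorphism on `R ⊗ S` is determined by its values on the generators. -/
theorem lift_comp (g : PropHom (tensor R S) T) : lift ((tensorMk R S).comp g) = g := by
  have key : ∀ {a b : Prof (R.Col × S.Col)} (f : TensorTerm R S a b),
      TensorTerm.eval ((tensorMk R S).comp g) f = g.map (Quotient.mk (tensorSetoid R S a b) f) := by
    intro a b f
    induction f with
    | left φ c => rfl
    | right a ψ => rfl
    | id a => exact (g.isHom.map_id a).symm
    | vcomp f f' ih ih' =>
      exact (congrArg₂ T.vcomp ih ih').trans (g.isHom.map_vcomp _ _).symm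
    | hcomp f f' ih ih' =>
      exact (congrArg (T.act _ _) (congrArg₂ T.hcomp ih ih')).trans (g.isHom.map_hcomp _ _).symm
    | pull σ f ih => exact (congrArg (T.pull _) ih).trans (g.isHom.map_pull σ _).symm
    | push τ f ih => exact (congrArg (T.push _) ih).trans (g.isHom.map_push τ _).symm
  obtain ⟨col, map, isHom⟩ := g
  have hmap : @PropHom.map _ _ (lift ((tensorMk R S).comp ⟨col, map, isHom⟩)) = @map := by
    funext a b f
    obtain ⟨f⟩ := f
    exact key f
  unfold lift at hmap ⊢
  congr

/-! ### Currying of homomorphisms -/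

/-- Evaluation `Hom(S, T) → T` at a colour of `S`. -/
def evalAt (T : ColoredProp.{u}) (c : S.Col) : PropHom (ihom S T) T where
  col := fun f : PropHom S T => f.col c
  map := fun ξ => NatTrans.app ξ c
  isHom :=
    { map_id _ := rfl
      map_vcomp _ _ := rfl
      map_hcomp _ _ := rfl
      map_pull _ _ := rfl
      map_push _ _ := rfl }

/-- The bilinear map `(φ, c) ↦ (hφ)_c`, `(a, ψ) ↦ (h a)ψ` of a homomorphism `h : R → Hom(S, T)`. -/
def Bilin.ofHom (h : PropHom R (ihom S T)) : Bilin R S T where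
  col a := PropHom.col (h.col a)
  left φ c := NatTrans.app (h.map φ) c
  right a _ _ ψ := PropHom.map (h.col a) ψ
  left_isHom c := (h.comp (evalAt T c)).isHom
  right_isHom a := PropHom.isHom (h.col a)
  octagon φ _ _ ψ := NatTrans.natural (h.map φ) ψ

/-- The homomorphism `R ⊗ S → T` that corresponds to `h : R → Hom(S, T)`. -/
def uncurry (h : PropHom R (ihom S T)) : PropHom (tensor R S) T :=
  lift (Bilin.ofHom h)

theorem uncurry_curry (g : PropHom (tensor R S) T) : uncurry (curry g) = g :=
  lift_comp g

theorem curry_uncurry (h : PropHom R (ihom S T)) : curry (uncurry h) = h :=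
  rfl

/-! ### Currying of natural transformations -/

/-- The homomorphism `Hom(R ⊗ S, T) → Hom(R, Hom(S, T))`, `ξ ↦ ((ξ_{(a, c)})_c)_a`. -/
def curryHom (R S T : ColoredProp.{u}) :
    PropHom (ihom (tensor R S) T) (ihom R (ihom S T)) where
  col := curry
  map {fs gs} ξ := (show NatTrans (fs.map curry) (gs.map curry) from
    { app := fun a => (show NatTrans (fs.map fun g => (curry g).col a)
          (gs.map fun g => (curry g).col a) from
        { app := fun c => NatTrans.app ξ (a, c)
          natural := fun ψ => NatTrans.natural ξ ((tensorMk R S).right a ψ) })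
      natural := fun φ => NatTrans.ext (funext fun c => map_octagon_of (evalAt T c).isHom
        (NatTrans.natural ξ ((tensorMk R S).left φ c))) })
  isHom :=
    { map_id _ := rfl
      map_vcomp _ _ := rfl
      map_hcomp {fs gs fs' gs'} ξ ζ := NatTrans.ext (funext fun a => NatTrans.ext (funext fun c =>
      by
        -- The three identifications of `x(fs) x(fs')` with `x(fs fs')`, where `x` is evaluation at
        -- `c`, evaluation at `a`, and currying.
        let σ (hs hs' : Prof (PropHom (tensor R S) T)) :=
          Prof.Iso.mapAppend (fun h : PropHom S T => h.col c)
            (hs.map fun h => (curry h).col a) (hs'.map fun h => (curry h).col a)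
        let σ' (hs hs' : Prof (PropHom (tensor R S) T)) :=
          (Prof.Iso.mapAppend (fun h : PropHom R (ihom S T) => h.col a)
            (hs.map curry) (hs'.map curry)).map fun h : PropHom S T => h.col c
        let σ'' (hs hs' : Prof (PropHom (tensor R S) T)) :=
          ((Prof.Iso.mapAppend curry hs hs').map
            fun h : PropHom R (ihom S T) => h.col a).map fun h : PropHom S T => h.col c
        have h := T.act_act (σ fs fs') (σ' fs fs') (σ gs gs') (σ' gs gs')
          (T.hcomp (NatTrans.app ξ (a, c)) (NatTrans.app ζ (a, c)))
        exact ((congrArg (T.act (σ'' fs fs') (σ'' gs gs')) h).trans (T.act_act _ _ _ _ _)).symm))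
      map_pull _ _ := rfl
      map_push _ _ := rfl }

/-- The homomorphism `Hom(R, Hom(S, T)) → Hom(R ⊗ S, T)`, `ξ ↦ ((ξ_a)_c)_{(a, c)}`. -/
def uncurryHom (R S T : ColoredProp.{u}) :
    PropHom (ihom R (ihom S T)) (ihom (tensor R S) T) where
  col := uncurry
  map {fs gs} ξ := (show NatTrans (fs.map uncurry) (gs.map uncurry) from
    { app := fun x => NatTrans.app (NatTrans.app ξ x.1) x.2
      natural := fun φ => NatTrans.naturalAt_iff.1 (naturalAt_tensor (fs := fs.map uncurry)
        (gs := gs.map uncurry) (app := fun x => NatTrans.app (NatTrans.app ξ x.1) x.2)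
        (fun φ c => NatTrans.naturalAt_iff.2
          (octagon_map (evalAt T c).isHom (NatTrans.natural ξ φ)))
        (fun a _ _ ψ => NatTrans.naturalAt_iff.2 (NatTrans.natural (NatTrans.app ξ a) ψ)) φ) })
  isHom :=
    { map_id _ := rfl
      map_vcomp _ _ := rfl
      map_hcomp {fs gs fs' gs'} ξ ζ := NatTrans.ext (funext fun x => by
        -- On the left, evaluation at `x.2` is followed by evaluation at `x.1`; on the right,
        -- evaluation at `x` is followed by uncurrying.
        let σ (hs hs' : Prof (PropHom R (ihom S T))) :=
          Prof.Iso.mapAppend (fun h : PropHom S T => h.col x.2)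
            (hs.map fun h => h.col x.1) (hs'.map fun h => h.col x.1)
        let σ' (hs hs' : Prof (PropHom R (ihom S T))) :=
          (Prof.Iso.mapAppend (fun h : PropHom R (ihom S T) => h.col x.1) hs hs').map
            fun h : PropHom S T => h.col x.2
        let ρ (hs hs' : Prof (PropHom R (ihom S T))) :=
          Prof.Iso.mapAppend (fun h : PropHom (tensor R S) T => h.col x)
            (hs.map uncurry) (hs'.map uncurry)
        let ρ' (hs hs' : Prof (PropHom R (ihom S T))) :=
          (Prof.Iso.mapAppend uncurry hs hs').map fun h : PropHom (tensor R S) T => h.col x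
        exact (T.act_act (σ fs fs') (σ' fs fs') (σ gs gs') (σ' gs gs')
          (T.hcomp (NatTrans.app (NatTrans.app ξ x.1) x.2)
            (NatTrans.app (NatTrans.app ζ x.1) x.2))).trans
          (T.act_act (ρ fs fs') (ρ' fs fs') (ρ gs gs') (ρ' gs gs') _).symm)
      map_pull _ _ := rfl
      map_push _ _ := rfl }

/-- Two homomorphisms are equal if they agree on colours and, after relabelling the inputs and
outputs along these equalities, on operations. -/
theorem PropHom.ext_act {A B : ColoredProp.{u}} {F G : PropHom A B}
    (hc : ∀ x, F.col x = G.col x)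
    (hm : ∀ {a b : Prof A.Col} (φ : A.Hom a b),
      B.act (a := a.map F.col) (a' := a.map G.col) (b := b.map F.col) (b' := b.map G.col)
        ⟨Equiv.refl _, fun i => (hc (a.get i)).symm⟩ ⟨Equiv.refl _, fun i => (hc (b.get i)).symm⟩
        (F.map φ) = G.map φ) : F = G := by
  obtain ⟨col, map, _⟩ := F
  obtain ⟨col', map', _⟩ := G
  obtain rfl : col = col' := funext hc
  obtain rfl : @map = @map' := by
    funext a b φ
    exact (B.act_refl _).symm.trans (hm φ)
  rfl

/-- The isomorphism `Hom(R ⊗ S, T) ≅ Hom(R, Hom(S, T))`. -/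
def tensorHomIso (R S T : ColoredProp.{u}) :
    ihom (tensor R S) T ≅ ihom R (ihom S T) where
  hom := curryHom R S T
  inv := uncurryHom R S T
  -- The round trips fix all components `ξ_{(a, c)}`; only the lists of homomorphisms that serve as
  -- source and target have to be identified along `uncurry_curry` and `curry_uncurry`.
  hom_inv_id := PropHom.ext_act uncurry_curry fun _ =>
    NatTrans.ext (funext fun _ => T.act_refl _)
  inv_hom_id := PropHom.ext_act curry_uncurry fun _ =>
    NatTrans.ext (funext fun _ => NatTrans.ext (funext fun _ => T.act_refl _))

end Tensor

end ColoredProp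

theorem propositionP :
    ∃ Φ : ∀ R S T : ColoredProp.{u},
        ColoredProp.ihom (ColoredProp.tensor R S) T ≅
          ColoredProp.ihom R (ColoredProp.ihom S T),
      (∀ (R S T : ColoredProp.{u}) (g : ColoredProp.PropHom (ColoredProp.tensor R S) T),
        ColoredProp.PropHom.col (Φ R S T).hom g = ColoredProp.curry g) ∧
      (∀ (R R' S S' T T' : ColoredProp.{u}) (f : ColoredProp.PropHom R' R)
        (g : ColoredProp.PropHom S' S) (h : ColoredProp.PropHom T T'),
        ColoredProp.PropHom.comp
            (ColoredProp.ihomMap (ColoredProp.tensorMap f g) h) (Φ R' S' T').hom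
          = ColoredProp.PropHom.comp (Φ R S T).hom
              (ColoredProp.ihomMap f (ColoredProp.ihomMap g h))) := by
  exact ⟨ColoredProp.tensorHomIso, fun _ _ _ _ => rfl, fun _ _ _ _ _ _ _ _ _ => rfl⟩
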